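/- Let $K$ be a field, $n\ge 1$, and let $R=K[x_1,\dots,x_n]$ have the standard grading. For a nonzero homogeneous ideal $J$ of $R$ and $j\ge 0$ let $t_j(J)$ be the largest degree of a minimal generator of the $j$-th syzygy module of $J$, that is, of a basis element of $F_j$ in a minimal graded free resolution $\cdots\to F_1\to F_0\to J\to 0$ over $R$, with $t_j(J)=-\infty$ if $F_j=0$; let $\operatorname{reg}(J)=\max\{t_j(J)-j : j\ge 0\}$, and let $\operatorname{pd}_R(J)$ be the projective dimension. Suprema of the empty set are $-\infty$. Let $I_1,\dots,I_m$ be nonzero homogeneous ideals of $R$, let $f_{i1},\dots,f_{ig_i}$ be a minimal homogeneous generating system of $I_i$, and set $d_{il}=\deg f_{il}$. For $a\in\mathbb N^m$ write $I^a=I_1^{a_1}\cdots I_m^{a_m}$, and say that a property holds for $a\gg 0$ if there is a $c\in\mathbb N^m$ such that it holds for all $a\in c+\mathbb N^m$. Then for every $0\le j\le n-1$ there exist $b_j\in\mathbb N$ and linear functions $$L^{(j)}_k(u)=\sum_{i=1}^m\lambda^{(j)}_{ki}u_i+\lambda^{(j)}_{k0},\qquad 1\le k\le b_j,$$ with $\lambda^{(j)}_{ki}\in\{d_{i1},\dots,d_{ig_i}\}$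 for $1\le i\le m$ and $\lambda^{(j)}_{k0}\in\mathbb Z$, such that $$t_j(I^a)=\sup\{L^{(j)}_k(a) : 1\le k\le b_j\}\quad\text{for } a\gg 0.$$ Moreover, $\operatorname{pd}_R(I^a)$ is constant for $a\gg 0$, and, with the same linear functions, $$\operatorname{reg}(I^a)=\sup\{L^{(j)}_k(a)-j : 0\le j\le n-1,\ 1\le k\le b_j\}\quad\text{for } a\gg 0.$$ -/

import Mathlib

open MvPolynomial CategoryTheory

attribute [local instance] MvPolynomial.gradedAlgebra

/-- `f 0, …, f (g - 1)` is a minimal homogeneous generating system of the ideal `I` of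
`K[x_1, …, x_n]`, where `f j` is homogeneous of degree `d j`. Since no generator is redundant,
all `f j` are nonzero, so that the degrees `d j` are determined by `f`. -/
structure IsMinimalHomogeneousGeneratingSystem {K : Type*} [Field K] {n g : ℕ}
    (I : Ideal (MvPolynomial (Fin n) K)) (f : Fin g → MvPolynomial (Fin n) K)
    (d : Fin g → ℕ) : Prop where
  span_eq : Ideal.span (Set.range f) = I
  homogeneous : ∀ j, (f j).IsHomogeneous (d j)
  irredundant : ∀ j, f j ∉ Ideal.span (f '' {j}ᶜ)

/-- A minimal graded free resolution
`⋯ → F_2 → F_1 → F_0 → I → 0` of an ideal `I` of `R = K[x_1, …, x_n]` by graded free modules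
`F_j = ⨁_k R(-deg j k)` of finite rank. The augmentation is written as a map `F_0 → R` with image
`I`. (As `I` lives in nonnegative degrees, so do the basis elements of all the `F_j`.) -/
structure MinimalGradedFreeResolution {K : Type*} [Field K] {n : ℕ}
    (I : Ideal (MvPolynomial (Fin n) K)) where
  /-- the rank of `F_j` -/
  rank : ℕ → ℕ
  /-- the degree of the `k`-th basis element of `F_j` -/
  deg : (j : ℕ) → Fin (rank j) → ℕ
  /-- the augmentation `F_0 → I ⊆ R` -/
  aug : (Fin (rank 0) → MvPolynomial (Fin n) K) →ₗ[MvPolynomial (Fin n) K] MvPolynomial (Fin n) K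
  /-- the differential `F_{j+1} → F_j` -/
  diff : (j : ℕ) → (Fin (rank (j + 1)) → MvPolynomial (Fin n) K) →ₗ[MvPolynomial (Fin n) K]
    (Fin (rank j) → MvPolynomial (Fin n) K)
  range_aug : LinearMap.range aug = I
  exact_zero : Function.Exact (diff 0) aug
  exact_succ : ∀ j, Function.Exact (diff (j + 1)) (diff j)
  /-- the augmentation preserves degrees -/
  aug_homogeneous : ∀ k, (aug (Pi.single k 1)).IsHomogeneous (deg 0 k)
  /-- the differentials preserve degrees: every nonzero matrix entry is homogeneous of degree
  the difference of the degrees of the two basis elements -/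
  diff_homogeneous : ∀ j k l, diff j (Pi.single k 1) l ≠ 0 →
    ∃ e : ℕ, deg (j + 1) k = deg j l + e ∧ (diff j (Pi.single k 1) l).IsHomogeneous e
  /-- minimality: all matrix entries of the differentials lie in `(x_1, …, x_n)` -/
  minimal : ∀ j k l, constantCoeff (diff j (Pi.single k 1) l) = 0

/-- `t_j(I)`: the largest degree of a minimal generator of the `j`-th syzygy module of `I`, i.e.
of a basis element of `F_j` in a minimal graded free resolution; `-∞` if `F_j = 0`. -/
noncomputable def maxSyzygyDegree {K : Type*} [Field K] {n : ℕ} (j : ℕ)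
    (I : Ideal (MvPolynomial (Fin n) K)) : EReal :=
  ⨆ (F : MinimalGradedFreeResolution I) (k : Fin (F.rank j)), ((F.deg j k : ℝ) : EReal)

/-- The Castelnuovo–Mumford regularity `max {t_j(I) - j : j ≥ 0}`. -/
noncomputable def castelnuovoMumfordRegularity {K : Type*} [Field K] {n : ℕ}
    (I : Ideal (MvPolynomial (Fin n) K)) : EReal :=
  ⨆ j : ℕ, (maxSyzygyDegree j I - ((j : ℝ) : EReal))

/-! Koszul homology replaces resolutions by something that depends on the ideal alone. Along a
minimal graded cover $F\to P$ one has $H_{j+1}(x;P)\cong H_j(x;\ker)$, since the Koszul complex of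
$F$ is acyclic and the kernel lies in $(x)F$; moreover $H_0(x;P)=P/(x)P$ shows the generator
degrees. Iterating, the basis degrees of $F_j$ in any minimal resolution of $I$ are the degrees in
which $H_j(x;I)\ne0$ (`MinimalGradedFreeResolution.hasKoszulClass_iff`).

All products $I^a$ are then treated at once. The multi-Rees algebra $\bigoplus_a I^a t^a$ is a
finitely generated, hence noetherian, $K$-algebra with generators $x_i$ of degree $(0,1)$ and
$f_{il}t_i$ of degree $(e_i,d_{il})$. Its Koszul homology is a finitely generated multigraded module
whose component at $(a,e)$ is $H_j(x;I^a)_e$ (`exists_homogeneousChains_iff`). A filtration by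
cyclic modules, each generated by a homogeneous element of maximal annihilator, shows that its set
of degrees is a finite union of shifted semigroups spanned by generator degrees
(`exists_cone_decomposition`). As the $x_i$ annihilate Koszul homology, only the vectors
$(e_i,d_{il})$ span.

Over a large $a$, a cone lacking a vector for some $i$ has no points, and any other cone has its
highest point at a height linear in $a$, with slope in direction $i$ the largest available $d_{il}$
(`exists_linear_bounds_of_cones`). This gives $t_j$. Whether $F_j$ vanishes no longer depends on
$a\gg0$, and $F_j=0$ for $j\ge n$, so the projective dimension, which is the length of a minimal
resolution, is constant; the regularity is a supremum of finitely many $t_j-j$. -/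

/-! ### The Koszul differential on chains of all homological degrees together -/

section Koszul

variable {ι R N : Type*} [LinearOrder ι] [CommRing R] [AddCommGroup N] [Module R N]

/-- The sign of moving `e_i` to its place in `⋀_{k ∈ s} e_k`. -/
def koszulSign (i : ι) (s : Finset ι) : ℤ := ∏ k ∈ s, if k < i then -1 else 1

lemma koszulSign_insert (i : ι) {k : ι} {s : Finset ι} (hk : k ∉ s) :
    koszulSign i (insert k s) = (if k < i then -1 else 1) * koszulSign i s :=
  Finset.prod_insert hk

lemma koszulSign_mul_self (i : ι) (s : Finset ι) : koszulSign i s * koszulSign i s = 1 := by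
  rw [koszulSign, ← Finset.prod_mul_distrib]
  exact Finset.prod_eq_one fun k _ => by split_ifs <;> rfl

lemma koszulSign_insert_self (i : ι) (s : Finset ι) :
    koszulSign i (insert i s) = koszulSign i s := by
  by_cases h : i ∈ s
  · rw [Finset.insert_eq_of_mem h]
  · rw [koszulSign_insert i h, if_neg (lt_irrefl i), one_mul]

lemma koszulSign_erase_self (i : ι) (s : Finset ι) :
    koszulSign i (s.erase i) = koszulSign i s := by
  by_cases h : i ∈ s
  · conv_rhs => rw [← Finset.insert_erase h, koszulSign_insert_self]
  · rw [Finset.erase_eq_of_notMem h]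

/-- Contraction with the `i`-th coordinate function on chains `∑ e_s ⊗ c s`. -/
def koszulContract (R : Type*) {N : Type*} [CommRing R] [AddCommGroup N] [Module R N] (i : ι) :
    (Finset ι → N) →ₗ[R] (Finset ι → N) where
  toFun c s := if i ∈ s then 0 else koszulSign i s • c (insert i s)
  map_add' c d := by
    ext s; by_cases h : i ∈ s <;> simp [h]
  map_smul' r c := by
    ext s; by_cases h : i ∈ s <;> simp [h, smul_comm r]

/-- Exterior multiplication by `e_i` on chains `∑ e_s ⊗ c s`. -/
def koszulWedge (R : Type*) {N : Type*} [CommRing R] [AddCommGroup N] [Module R N] (i : ι) :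
    (Finset ι → N) →ₗ[R] (Finset ι → N) where
  toFun c s := if i ∈ s then koszulSign i s • c (s.erase i) else 0
  map_add' c d := by
    ext s; by_cases h : i ∈ s <;> simp [h]
  map_smul' r c := by
    ext s; by_cases h : i ∈ s <;> simp [h, smul_comm r]

lemma koszulContract_apply (i : ι) (c : Finset ι → N) (s : Finset ι) :
    koszulContract R i c s = if i ∈ s then 0 else koszulSign i s • c (insert i s) := rfl

lemma koszulWedge_apply (i : ι) (c : Finset ι → N) (s : Finset ι) :
    koszulWedge R i c s = if i ∈ s then koszulSign i s • c (s.erase i) else 0 := rfl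

lemma koszulContract_self (i : ι) (c : Finset ι → N) :
    koszulContract R i (koszulContract R i c) = 0 := by
  ext s; simp [koszulContract_apply]

lemma koszulContract_comm (i k : ι) (c : Finset ι → N) :
    koszulContract R i (koszulContract R k c) = - koszulContract R k (koszulContract R i c) := by
  rcases eq_or_ne i k with rfl | hik
  · simp [koszulContract_self]
  ext s
  by_cases hi : i ∈ s
  · simp [koszulContract_apply, hi]
  by_cases hk : k ∈ s
  · simp [koszulContract_apply, hk]
  simp only [koszulContract_apply, hi, hk, if_false, Pi.neg_apply, Finset.mem_insert, hik,
    hik.symm, or_self, koszulSign_insert _ hi, koszulSign_insert _ hk, Finset.insert_comm i k,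
    smul_smul, ← neg_smul]
  congr 1
  rcases lt_or_gt_of_ne hik with h | h
  · simp [h, h.not_gt, mul_comm]
  · simp [h, h.not_gt, mul_comm]

lemma koszulContract_wedge_self (i : ι) (c : Finset ι → N) :
    koszulContract R i (koszulWedge R i c) = c - koszulWedge R i (koszulContract R i c) := by
  ext s
  by_cases hi : i ∈ s
  · simp [koszulContract_apply, koszulWedge_apply, hi, smul_smul, koszulSign_erase_self,
      koszulSign_mul_self]
  · simp [koszulContract_apply, koszulWedge_apply, hi, smul_smul, koszulSign_insert_self,
      koszulSign_mul_self]

lemma koszulContract_wedge {i k : ι} (hik : i ≠ k) (c : Finset ι → N) :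
    koszulContract R i (koszulWedge R k c) = - koszulWedge R k (koszulContract R i c) := by
  ext s
  by_cases hi : i ∈ s
  · simp [koszulContract_apply, koszulWedge_apply, hi, hik]
  by_cases hk : k ∈ s
  · have h1 : i ∉ s.erase k := fun h => hi (Finset.mem_of_mem_erase h)
    have h2 : (insert i s).erase k = insert i (s.erase k) := Finset.erase_insert_of_ne hik
    have h3 : koszulSign i s = (if k < i then -1 else 1) * koszulSign i (s.erase k) := by
      rw [← koszulSign_insert i (Finset.notMem_erase k s), Finset.insert_erase hk]
    simp only [koszulContract_apply, koszulWedge_apply, hi, hk, if_false, if_true, Pi.neg_apply,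
      Finset.mem_insert, hik.symm, false_or, h1, h2, koszulSign_insert _ hi, smul_smul,
      ← neg_smul, h3]
    congr 1
    rcases lt_or_gt_of_ne hik with h | h
    · simp [h, h.not_gt, mul_comm]
    · simp [h, h.not_gt, mul_comm]
  · simp [koszulContract_apply, koszulWedge_apply, hi, hk, hik.symm]

/-- The Koszul differential `∑_{i ∈ T} x_i • (contraction with e_i)`. -/
def koszulOn (x : ι → R) (T : Finset ι) : (Finset ι → N) →ₗ[R] (Finset ι → N) :=
  ∑ i ∈ T, x i • koszulContract R i

lemma koszulOn_apply (x : ι → R) (T : Finset ι) (c : Finset ι → N) :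
    koszulOn x T c = ∑ i ∈ T, x i • koszulContract R i c := by
  simp [koszulOn]

lemma koszulOn_apply_apply (x : ι → R) (T : Finset ι) (c : Finset ι → N) (s : Finset ι) :
    koszulOn x T c s =
      ∑ i ∈ T, if i ∈ s then 0 else koszulSign i s • x i • c (insert i s) := by
  simp only [koszulOn_apply, Finset.sum_apply, Pi.smul_apply, koszulContract_apply]
  refine Finset.sum_congr rfl fun i _ => ?_
  split_ifs
  · exact smul_zero _
  · exact smul_comm _ _ _

lemma koszulOn_insert (x : ι → R) {T : Finset ι} {k : ι} (hk : k ∉ T) (c : Finset ι → N) :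
    koszulOn x (insert k T) c = x k • koszulContract R k c + koszulOn x T c := by
  simp [koszulOn_apply, Finset.sum_insert hk]

lemma koszulOn_contract (x : ι → R) (T : Finset ι) (k : ι) (c : Finset ι → N) :
    koszulOn x T (koszulContract R k c) = - koszulContract R k (koszulOn x T c) := by
  simp only [koszulOn_apply, map_sum, map_smul, koszulContract_comm _ k, smul_neg,
    Finset.sum_neg_distrib]

lemma koszulOn_koszulOn (x : ι → R) (T : Finset ι) (c : Finset ι → N) :
    koszulOn x T (koszulOn x T c) = 0 := by
  induction T using Finset.induction_on generalizing c with
  | empty => simp [koszulOn_apply]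
  | insert k T hk ih =>
    rw [koszulOn_insert x hk, koszulOn_insert x hk]
    simp only [map_add, map_smul, koszulContract_self, ih, koszulOn_contract]
    simp

lemma koszulOn_wedge_of_notMem (x : ι → R) {T : Finset ι} {k : ι} (hk : k ∉ T)
    (c : Finset ι → N) :
    koszulOn x T (koszulWedge R k c) = - koszulWedge R k (koszulOn x T c) := by
  simp only [koszulOn_apply, map_sum, map_smul, ← Finset.sum_neg_distrib]
  refine Finset.sum_congr rfl fun i hi => ?_
  rw [koszulContract_wedge (by rintro rfl; exact hk hi), smul_neg]

/-- Exterior multiplication by $e_k$ is a null-homotopy of multiplication by $x_k$. This drives the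
induction for acyclicity and later shows that the variables annihilate Koszul homology. -/
lemma koszulOn_wedge (x : ι → R) {T : Finset ι} {k : ι} (hk : k ∈ T) (c : Finset ι → N) :
    koszulOn x T (koszulWedge R k c) = x k • c - koszulWedge R k (koszulOn x T c) := by
  obtain ⟨T, hkT, rfl⟩ : ∃ T' : Finset ι, k ∉ T' ∧ insert k T' = T :=
    ⟨T.erase k, Finset.notMem_erase k T, Finset.insert_erase hk⟩
  rw [koszulOn_insert x hkT, koszulOn_insert x hkT,
    koszulOn_wedge_of_notMem x hkT, koszulContract_wedge_self]
  simp only [map_add, map_smul, smul_sub]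
  abel

/-- The maps may vary with `s` because degree projections depend on the cardinality of `s`, and two
families are allowed so that each can be cut off to one homological degree, source and target being
one apart. -/
lemma koszulOn_map {R' N' : Type*} [CommRing R'] [AddCommGroup N'] [Module R' N']
    (x : ι → R) (x' : ι → R') (T : Finset ι) (f g : Finset ι → N →+ N')
    (hfg : ∀ i s u, i ∉ s → f s (x i • u) = x' i • g (insert i s) u) (c : Finset ι → N) :
    koszulOn x' T (fun s => g s (c s)) = fun s => f s (koszulOn x T c s) := by
  ext s
  simp only [koszulOn_apply_apply, map_sum]
  refine Finset.sum_congr rfl fun i _ => ?_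
  split_ifs with h
  · simp
  · rw [map_zsmul, hfg i s _ h]

end Koszul

/-! ### Acyclicity of the Koszul complex of the polynomial ring -/

section Acyclic

variable {ι R : Type*} [LinearOrder ι] [CommRing R]

lemma koszulContract_eq_zero_of_supported {N : Type*} [AddCommGroup N] [Module R N]
    {T : Finset ι} {k : ι} (hk : k ∉ T) {c : Finset ι → N} (hc : ∀ s, ¬ s ⊆ T → c s = 0) :
    koszulContract R k c = 0 := by
  ext s
  rw [koszulContract_apply]
  split_ifs with h
  · rfl
  · rw [hc _ fun h' => hk (h' (Finset.mem_insert_self k s)), smul_zero]; rfl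

/-- For a regular sequence in any order, the Koszul complex is exact in positive degrees. -/
lemma koszulOn_exact_of_supported (x : ι → R)
    (hreg : ∀ (T : Finset ι) (k : ι), k ∉ T → ∀ r, x k * r ∈ Ideal.span (x '' T) →
      r ∈ Ideal.span (x '' T))
    (T : Finset ι) (c : Finset ι → R) (hc : ∀ s, ¬ s ⊆ T → c s = 0)
    (hcyc : koszulOn x T c = 0) (h0 : c ∅ ∈ Ideal.span (x '' T)) :
    ∃ w : Finset ι → R, (∀ s, ¬ s ⊆ T → w s = 0) ∧ koszulOn x T w = c := by
  induction T using Finset.induction_on generalizing c with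
  | empty =>
    refine ⟨0, fun _ _ => rfl, ?_⟩
    rw [map_zero]
    ext s
    by_cases hs : s ⊆ ∅
    · rw [Finset.subset_empty.mp hs]
      simpa [eq_comm] using h0
    · exact (hc s hs).symm
  | insert k T hk ih =>
    -- Write $c=u+e_k\wedge v$ with $u$ and $v$ free of $e_k$. The cycle condition splits into
    -- $\partial_T v=0$ and $\partial_T u=-x_kv$, so regularity of $x_k$ allows the induction
    -- hypothesis to be applied to $v$.
    set v := koszulContract R k c with hv
    set u := c - koszulWedge R k v with hu
    have hvs : ∀ s, ¬ s ⊆ T → v s = 0 := by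
      intro s hs
      rw [hv, koszulContract_apply]
      split_ifs with h
      · rfl
      · rw [hc, smul_zero]
        intro h'
        refine hs fun i hi => ?_
        have := h' (Finset.mem_insert_of_mem hi)
        rcases Finset.mem_insert.mp this with rfl | h2
        · exact absurd hi h
        · exact h2
    have hus : ∀ s, ¬ s ⊆ T → u s = 0 := by
      intro s hs
      rw [hu, Pi.sub_apply, koszulWedge_apply]
      split_ifs with h
      · rw [hv, koszulContract_apply, if_neg (Finset.notMem_erase k s), Finset.insert_erase h,
          smul_smul, koszulSign_erase_self, koszulSign_mul_self, one_smul, sub_self]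
      · rw [sub_zero, hc]
        intro h'
        refine hs fun i hi => ?_
        rcases Finset.mem_insert.mp (h' hi) with rfl | h2
        · exact absurd hi h
        · exact h2
    have hDv : koszulContract R k v = 0 := koszulContract_eq_zero_of_supported hk hvs
    have hcuv : c = u + koszulWedge R k v := by rw [hu]; abel
    have e1 : x k • v + koszulOn x T c = 0 := by
      rw [← hcyc, koszulOn_insert x hk]
    have hv0 : koszulOn x T v = 0 := by
      have h := koszulOn_contract x T k c
      have h2 : koszulOn x T c = - (x k • v) := by
        rw [eq_neg_iff_add_eq_zero, add_comm]; exact e1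
      rw [h2, map_neg, map_smul, hDv, smul_zero, neg_zero, neg_zero] at h
      exact h
    have hTu : koszulOn x T u = - (x k • v) := by
      rw [hu, map_sub, koszulOn_wedge_of_notMem x hk, hv0, map_zero, neg_zero, sub_zero,
        eq_neg_iff_add_eq_zero, add_comm]
      exact e1
    have hv00 : v ∅ ∈ Ideal.span (x '' (T : Set ι)) := by
      refine hreg T k hk _ ?_
      have h : x k * v ∅ = - koszulOn x T u ∅ := by rw [hTu]; simp
      rw [h, koszulOn_apply_apply]
      refine neg_mem (Ideal.sum_mem _ fun i hi => ?_)
      simp only [Finset.notMem_empty, if_false]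
      have hx : x i ∈ Ideal.span (x '' (T : Set ι)) := Ideal.subset_span ⟨i, hi, rfl⟩
      exact zsmul_mem (Ideal.mul_mem_right _ _ hx) _
    obtain ⟨w, hws, hw⟩ := ih v hvs hv0 hv00
    have hc0 : c ∅ ∈ Ideal.span {x k} ⊔ Ideal.span (x '' (T : Set ι)) := by
      rw [← Ideal.span_union, Set.singleton_union]
      simpa [Set.image_insert_eq] using h0
    obtain ⟨y, hy, r, hr, hyr⟩ := Submodule.mem_sup.mp hc0
    obtain ⟨q, rfl⟩ := Ideal.mem_span_singleton'.mp hy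
    -- With $v=\partial_Tw$, the chain $u+x_kw$ is a $T$-cycle, but its value at `∅` lies in $(x_T)$
    -- only up to a multiple of $x_k$. Subtracting $x_ke$ leaves exactly $r\in(x_T)$, and
    -- $x_ke=\partial(e_k\wedge e)$ is itself a boundary.
    let e : Finset ι → R := Pi.single ∅ (q + w ∅)
    have hes : ∀ s, ¬ s ⊆ (∅ : Finset ι) → e s = 0 := by
      intro s hs
      exact Pi.single_eq_of_ne (fun h => hs (by rw [h])) _
    have hTe : koszulOn x T e = 0 := by
      rw [koszulOn_apply]
      exact Finset.sum_eq_zero fun i _ => by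
        rw [koszulContract_eq_zero_of_supported (Finset.notMem_empty i) hes, smul_zero]
    have huw0 : (u + x k • w - x k • e) ∅ ∈ Ideal.span (x '' (T : Set ι)) := by
      have h1 : u ∅ = c ∅ := by simp [hu, koszulWedge_apply]
      have h2 : (u + x k • w - x k • e) ∅ = r := by
        simp only [Pi.add_apply, Pi.sub_apply, Pi.smul_apply, h1, ← hyr, e, Pi.single_eq_same,
          smul_eq_mul]
        ring
      rwa [h2]
    have hsub : ∀ z : Finset ι → R, (∀ s, ¬ s ⊆ T → z s = 0) →
        koszulOn x (insert k T) z = koszulOn x T z := fun z hz => by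
      rw [koszulOn_insert x hk, koszulContract_eq_zero_of_supported hk hz, smul_zero, zero_add]
    have hesT : ∀ s, ¬ s ⊆ T → e s = 0 := fun s hs =>
      hes s fun h => hs (h.trans (Finset.empty_subset T))
    obtain ⟨w', hws', hw'⟩ := ih (u + x k • w - x k • e)
      (fun s hs => by simp [hus s hs, hws s hs, hesT s hs])
      (by rw [map_sub, map_add, map_smul, map_smul, hTu, hw, hTe]; simp) huw0
    have hwedge : ∀ z : Finset ι → R, (∀ s, ¬ s ⊆ T → z s = 0) → ∀ s, ¬ s ⊆ insert k T →
        koszulWedge R k z s = 0 := fun z hz s hs => by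
      rw [koszulWedge_apply]
      split_ifs
      · rw [hz, smul_zero]
        exact fun h => hs (Finset.subset_insert_iff.mpr h)
      · rfl
    refine ⟨w' + koszulWedge R k e - koszulWedge R k w, fun s hs => ?_, ?_⟩
    · have h1 : w' s = 0 := hws' s fun h => hs (h.trans (Finset.subset_insert k T))
      simp [h1, hwedge e hesT s hs, hwedge w hws s hs]
    · have hkT := Finset.mem_insert_self k T
      rw [map_sub, map_add, koszulOn_wedge x hkT, koszulOn_wedge x hkT, hsub _ hws', hsub _ hesT,
        hsub _ hws, hTe, hw, hw', map_zero]
      conv_rhs => rw [hcuv]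
      abel

/-- Membership in an ideal generated by variables is tested monomial by monomial, and multiplication
by `X k` changes no exponent at an index in `T`. -/
lemma MvPolynomial.mem_span_X_of_X_mul_mem {σ K : Type*} [Field K] {T : Set σ} {k : σ}
    (hk : k ∉ T) (r : MvPolynomial σ K) (h : X k * r ∈ Ideal.span (X '' T)) :
    r ∈ Ideal.span (X '' T : Set (MvPolynomial σ K)) := by
  classical
  rw [mem_ideal_span_X_image] at h ⊢
  intro d hd
  obtain ⟨i, hi, hne⟩ := h (Finsupp.single k 1 + d) (by
    rw [mem_support_iff] at hd ⊢
    rwa [coeff_X_mul])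
  refine ⟨i, hi, ?_⟩
  have : k ≠ i := by rintro rfl; exact hk hi
  simpa [this] using hne

/-- The Koszul differential of a module over `K[x_1, …, x_n]`. -/
noncomputable def koszul (K : Type*) {N : Type*} [Field K] {n : ℕ} [AddCommGroup N]
    [Module (MvPolynomial (Fin n) K) N] :
    (Finset (Fin n) → N) →ₗ[MvPolynomial (Fin n) K] (Finset (Fin n) → N) :=
  koszulOn (fun i => X i) Finset.univ

/-- The condition on `c ∅` removes the only homology, $H_0=K$; chains of mixed homological degree
are allowed. -/
lemma koszul_exact {K : Type*} [Field K] {n : ℕ} (c : Finset (Fin n) → MvPolynomial (Fin n) K)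
    (hcyc : koszul K c = 0) (h0 : constantCoeff (c ∅) = 0) :
    ∃ w : Finset (Fin n) → MvPolynomial (Fin n) K, koszul K w = c := by
  obtain ⟨w, -, hw⟩ := koszulOn_exact_of_supported (fun i => (X i : MvPolynomial (Fin n) K))
    (fun T k hk r hr => mem_span_X_of_X_mul_mem (T := (T : Set (Fin n))) (by simpa using hk) r hr)
    Finset.univ c (fun s hs => absurd (Finset.subset_univ s) hs) hcyc (by
      refine mem_ideal_span_X_image.mpr fun d hd => ?_
      by_contra! h
      have : d = 0 := by ext i; simpa using h i (by simp)
      rw [mem_support_iff, this] at hd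
      exact hd h0)
  exact ⟨w, hw⟩

end Acyclic

/-! ### Graded Koszul homology and dimension shifting -/

section KoszulModule

variable {K : Type*} [Field K] {n : ℕ}
variable {N : Type*} [AddCommGroup N] [Module (MvPolynomial (Fin n) K) N]

lemma koszul_apply (c : Finset (Fin n) → N) (s : Finset (Fin n)) :
    koszul K c s = ∑ i, if i ∈ s then 0 else
      koszulSign i s • (X i : MvPolynomial (Fin n) K) • c (insert i s) :=
  koszulOn_apply_apply _ _ _ _

lemma koszul_koszul (c : Finset (Fin n) → N) : koszul K (koszul K c) = 0 :=
  koszulOn_koszulOn _ _ c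

lemma koszul_comp {N' : Type*} [AddCommGroup N'] [Module (MvPolynomial (Fin n) K) N']
    (π : N →ₗ[MvPolynomial (Fin n) K] N') (c : Finset (Fin n) → N) :
    koszul K (fun s => π (c s)) = fun s => π (koszul K c s) :=
  koszulOn_map _ _ _ (fun _ => π.toAddMonoidHom) (fun _ => π.toAddMonoidHom)
    (fun _ _ _ _ => π.map_smul _ _) c

lemma koszul_apply_eq_zero_of_card {c : Finset (Fin n) → N} {j : ℕ}
    (hc : ∀ s, s.card ≠ j + 1 → c s = 0) {s : Finset (Fin n)} (hs : s.card ≠ j) :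
    koszul K c s = 0 := by
  rw [koszul_apply]
  refine Finset.sum_eq_zero fun i _ => ?_
  split_ifs with h
  · rfl
  · rw [hc, smul_zero, smul_zero]
    rw [Finset.card_insert_of_notMem h]
    omega

lemma koszul_eq_zero_of_card {c : Finset (Fin n) → N}
    (hc : ∀ s, s.card ≠ 0 → c s = 0) : koszul K c = 0 := by
  ext s
  rw [koszul_apply]
  refine Finset.sum_eq_zero fun i _ => ?_
  split_ifs with h
  · rfl
  · rw [hc, smul_zero, smul_zero]
    rw [Finset.card_insert_of_notMem h]
    omega

/-- Projections onto the graded components of a `ℤ`-graded module over `K[x_1, …, x_n]`. -/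
structure DegreeProjection (K : Type*) [Field K] (n : ℕ) (N : Type*) [AddCommGroup N]
    [Module (MvPolynomial (Fin n) K) N] where
  /-- the projection onto the component of degree `d` -/
  proj : ℤ → N →+ N
  proj_proj : ∀ d u, proj d (proj d u) = proj d u
  proj_X_smul : ∀ d i u, proj (d + 1) ((X i : MvPolynomial (Fin n) K) • u) =
    (X i : MvPolynomial (Fin n) K) • proj d u

/-- The `j`-th Koszul homology of `P` is nonzero in degree `d`. -/
def HasKoszulClass (G : DegreeProjection K n N) (P : Submodule (MvPolynomial (Fin n) K) N)
    (j : ℕ) (d : ℤ) : Prop :=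
  ∃ c : Finset (Fin n) → N, (∀ s, c s ∈ P) ∧ (∀ s, s.card ≠ j → c s = 0) ∧
    (∀ s, G.proj (d - j) (c s) = c s) ∧ koszul K c = 0 ∧
    ¬ ∃ w : Finset (Fin n) → N, (∀ s, w s ∈ P) ∧ koszul K w = c

/-- A chain in degree $j\ge n$ can live only on `Finset.univ`, and there the cycle condition says
that $x_i$ times the coefficient vanishes. Torsion-freeness makes the cycle zero. -/
lemma not_hasKoszulClass_of_le (hn : 1 ≤ n) [NoZeroSMulDivisors (MvPolynomial (Fin n) K) N]
    (G : DegreeProjection K n N) (P : Submodule (MvPolynomial (Fin n) K) N) {j : ℕ} (hj : n ≤ j)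
    (d : ℤ) : ¬ HasKoszulClass G P j d := by
  rintro ⟨c, -, hcj, -, hcyc, hb⟩
  refine hb ⟨0, fun _ => zero_mem _, ?_⟩
  rw [map_zero]
  ext s
  symm
  by_cases hs : s = Finset.univ
  · subst hs
    let i : Fin n := ⟨0, hn⟩
    have h := congrFun hcyc (Finset.univ.erase i)
    rw [koszul_apply, Finset.sum_eq_single i] at h
    · rw [if_neg (Finset.notMem_erase i _), Finset.insert_erase (Finset.mem_univ i),
        ← Int.cast_smul_eq_zsmul (MvPolynomial (Fin n) K), smul_smul] at h
      rcases smul_eq_zero.mp h with h | h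
      · exfalso
        rcases mul_eq_zero.mp h with h | h
        · have := congrArg (Int.cast : ℤ → MvPolynomial (Fin n) K)
            (koszulSign_mul_self i (Finset.univ.erase i))
          rw [Int.cast_mul, h] at this
          simp at this
        · exact X_ne_zero i h
      · exact h
    · intro k _ hk
      rw [if_pos (Finset.mem_erase.mpr ⟨hk, Finset.mem_univ k⟩)]
    · exact fun h => absurd (Finset.mem_univ i) h
  · refine hcj s (ne_of_lt (lt_of_lt_of_le ?_ hj))
    simpa using Finset.card_lt_univ_of_notMem (s := s)
      (Classical.not_forall.mp fun h => hs (Finset.eq_univ_iff_forall.mpr h)).choose_spec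

/-- The part of degree `d` of a polynomial, for an integer `d`. -/
noncomputable def intComponent (d : ℤ) : MvPolynomial (Fin n) K →ₗ[K] MvPolynomial (Fin n) K :=
  if 0 ≤ d then homogeneousComponent d.toNat else 0

lemma intComponent_natCast (e : ℕ) :
    (intComponent (e : ℤ) : MvPolynomial (Fin n) K →ₗ[K] _) = homogeneousComponent e := by
  simp [intComponent]

lemma intComponent_of_isHomogeneous {p : MvPolynomial (Fin n) K} {e : ℕ} (hp : p.IsHomogeneous e)
    (d : ℤ) : intComponent d p = if d = e then p else 0 := by
  by_cases hd : 0 ≤ d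
  · lift d to ℕ using hd
    rw [intComponent_natCast, homogeneousComponent_of_mem hp]
    norm_cast
  · rw [intComponent, if_neg hd, if_neg (by omega)]; rfl

lemma intComponent_intComponent (d : ℤ) (p : MvPolynomial (Fin n) K) :
    intComponent d (intComponent d p) = intComponent d p := by
  by_cases hd : 0 ≤ d
  · lift d to ℕ using hd
    rw [intComponent_natCast,
      homogeneousComponent_eq_self (homogeneousComponent_isHomogeneous d p)]
  · simp [intComponent, hd]

lemma exists_isHomogeneous_of_intComponent_eq {d : ℤ} {p : MvPolynomial (Fin n) K}
    (h : intComponent d p = p) : p = 0 ∨ ∃ e : ℕ, d = e ∧ p.IsHomogeneous e := by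
  by_cases hd : 0 ≤ d
  · lift d to ℕ using hd
    rw [intComponent_natCast] at h
    exact Or.inr ⟨d, rfl, h ▸ homogeneousComponent_isHomogeneous d p⟩
  · left
    rw [← h, intComponent, if_neg hd]; rfl

lemma constantCoeff_intComponent {d : ℤ} (hd : d ≠ 0) (p : MvPolynomial (Fin n) K) :
    constantCoeff (intComponent d p) = 0 := by
  rw [intComponent]
  split_ifs with h
  · rw [constantCoeff_eq, coeff_homogeneousComponent, if_neg]
    simp only [map_zero]
    omega
  · simp

lemma intComponent_mul {q : MvPolynomial (Fin n) K} {e : ℕ} (hq : q.IsHomogeneous e) (d : ℤ)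
    (p : MvPolynomial (Fin n) K) : intComponent (d + e) (p * q) = intComponent d p * q := by
  induction p using MvPolynomial.induction_on' with
  | monomial m a =>
    have hm : (monomial m a : MvPolynomial (Fin n) K).IsHomogeneous m.degree :=
      isHomogeneous_monomial a rfl
    rw [intComponent_of_isHomogeneous hm, intComponent_of_isHomogeneous (hm.mul hq)]
    push_cast
    simp
  | add p p' hp hp' => rw [add_mul, map_add, map_add, hp, hp', add_mul]

/-- The standard grading of `K[x_1, …, x_n]`. -/
noncomputable def polynomialProjection (K : Type*) [Field K] (n : ℕ) :
    DegreeProjection K n (MvPolynomial (Fin n) K) where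
  proj d := (intComponent d).toAddMonoidHom
  proj_proj := intComponent_intComponent
  proj_X_smul d i u := by
    have := intComponent_mul (isHomogeneous_X K i) d u
    simpa [mul_comm] using this

/-- The grading of the free module `⨁ R(-δ k)`. -/
noncomputable def freeProjection (K : Type*) [Field K] (n : ℕ) {r : ℕ} (δ : Fin r → ℕ) :
    DegreeProjection K n (Fin r → MvPolynomial (Fin n) K) where
  proj d :=
    { toFun := fun u k => intComponent (d - δ k) (u k)
      map_zero' := by ext; simp
      map_add' := fun u v => by ext; simp }
  proj_proj d u := funext fun k => intComponent_intComponent _ _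
  proj_X_smul d i u := funext fun k => by
    have := intComponent_mul (isHomogeneous_X K i) (d - δ k) (u k)
    rw [Nat.cast_one, sub_add_eq_add_sub, mul_comm, mul_comm _ (X i)] at this
    exact this

lemma freeProjection_apply {r : ℕ} (δ : Fin r → ℕ) (d : ℤ) (u : Fin r → MvPolynomial (Fin n) K)
    (k : Fin r) : (freeProjection K n δ).proj d u k = intComponent (d - δ k) (u k) := rfl

lemma freeProjection_single {r : ℕ} (δ : Fin r → ℕ) (k : Fin r) :
    (freeProjection K n δ).proj (δ k) (Pi.single k 1) =
      (Pi.single k 1 : Fin r → MvPolynomial (Fin n) K) := by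
  ext1 l
  rw [freeProjection_apply]
  rcases eq_or_ne l k with rfl | h
  · rw [Pi.single_eq_same, intComponent_of_isHomogeneous (isHomogeneous_one (Fin n) K)]
    simp
  · rw [Pi.single_eq_of_ne h, map_zero]

lemma koszul_exact_free {r : ℕ} (c : Finset (Fin n) → Fin r → MvPolynomial (Fin n) K)
    (hcyc : koszul K c = 0) (h0 : ∀ k, constantCoeff (c ∅ k) = 0) :
    ∃ w : Finset (Fin n) → Fin r → MvPolynomial (Fin n) K, koszul K w = c := by
  have hcoord (z : Finset (Fin n) → Fin r → MvPolynomial (Fin n) K) (k : Fin r) :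
      koszul K (fun s => z s k) = fun s => koszul K z s k :=
    koszul_comp (LinearMap.proj k) z
  choose w hw using fun k => koszul_exact (fun s => c s k)
    (by rw [hcoord, hcyc]; rfl) (h0 k)
  refine ⟨fun s k => w k s, ?_⟩
  ext1 s
  ext1 k
  rw [← congrFun (hw k) s]
  exact (congrFun (hcoord (fun s k => w k s) k) s).symm

lemma constantCoeff_koszul {r : ℕ} (c : Finset (Fin n) → Fin r → MvPolynomial (Fin n) K)
    (s : Finset (Fin n)) (k : Fin r) : constantCoeff (koszul K c s k) = 0 := by
  rw [koszul_apply, Finset.sum_apply, map_sum]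
  refine Finset.sum_eq_zero fun i _ => ?_
  split_ifs <;> simp

variable (G : DegreeProjection K n N) {r : ℕ} (δ : Fin r → ℕ)
  (π : (Fin r → MvPolynomial (Fin n) K) →ₗ[MvPolynomial (Fin n) K] N)

/-- Koszul homology of a module is that of its first syzygy module, shifted by one. -/
lemma hasKoszulClass_range_succ_iff
    (hπ : ∀ d u, π ((freeProjection K n δ).proj d u) = G.proj d (π u))
    (hker : ∀ u, π u = 0 → ∀ k, constantCoeff (u k) = 0) (j : ℕ) (d : ℤ) :
    HasKoszulClass G (LinearMap.range π) (j + 1) d ↔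
      HasKoszulClass (freeProjection K n δ) (LinearMap.ker π) j d := by
  constructor
  · rintro ⟨c, hcP, hcj, hcd, hcyc, hb⟩
    choose v hv using hcP
    -- A homogeneous lift of `c` to the free module; its boundary lies in the kernel and represents
    -- the connecting homomorphism.
    let w : Finset (Fin n) → Fin r → MvPolynomial (Fin n) K := fun s =>
      if s.card = j + 1 then (freeProjection K n δ).proj (d - (j + 1 : ℕ)) (v s) else 0
    have hw : (fun s => π (w s)) = c := by
      ext s
      simp only [w]
      split_ifs with h
      · rw [hπ, hv, hcd]
      · rw [map_zero, hcj s h]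
    refine ⟨koszul K w, fun s => ?_, fun s hs => koszul_apply_eq_zero_of_card
      (fun s hs => if_neg hs) hs, fun s => ?_, koszul_koszul w, ?_⟩
    · rw [LinearMap.mem_ker, ← congrFun (koszul_comp π w) s, hw, hcyc]; rfl
    · rw [koszul_apply, map_sum]
      refine Finset.sum_congr rfl fun i _ => ?_
      split_ifs with h
      · simp
      · have e : d - (j : ℤ) = d - (j + 1 : ℕ) + 1 := by push_cast; ring
        rw [map_zsmul, e, DegreeProjection.proj_X_smul]
        congr 2
        simp only [w]
        split_ifs
        · rw [DegreeProjection.proj_proj]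
        · rw [map_zero]
    · rintro ⟨z, hzP, hz⟩
      -- Minimality enters for `j = 0`: the kernel lies in $(x)F$, so the cycle `w - z` meets no
      -- $H_0$ of the free module and is a boundary.
      have hz0 : ∀ k, constantCoeff ((w - z) ∅ k) = 0 := fun k => by
        have h1 := hker (z ∅) (hzP ∅) k
        have h2 : w ∅ = 0 := if_neg (by simp)
        simp [h1, h2]
      obtain ⟨q, hq⟩ := koszul_exact_free (w - z) (by rw [map_sub, hz, sub_self]) hz0
      refine hb ⟨fun s => π (q s), fun s => ⟨_, rfl⟩, ?_⟩
      rw [koszul_comp, hq, ← hw]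
      ext s
      have : π (z s) = 0 := hzP s
      simp [this]
  · rintro ⟨c, hcP, hcj, hcd, hcyc, hb⟩
    obtain ⟨v, hv⟩ := koszul_exact_free c hcyc (hker _ (hcP ∅))
    -- The preimage `v` is not homogeneous. Projecting each of its components to internal degree `d
    -- - (j + 1)` in homological degree `j + 1` keeps the boundary equal to `c`.
    let f : Finset (Fin n) → (Fin r → MvPolynomial (Fin n) K) →+ (Fin r → MvPolynomial (Fin n) K) :=
      fun s => if s.card = j then (freeProjection K n δ).proj (d - j) else 0
    let g : Finset (Fin n) → (Fin r → MvPolynomial (Fin n) K) →+ (Fin r → MvPolynomial (Fin n) K) :=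
      fun s => if s.card = j + 1 then (freeProjection K n δ).proj (d - (j + 1 : ℕ)) else 0
    let w : Finset (Fin n) → Fin r → MvPolynomial (Fin n) K := fun s => g s (v s)
    have hw : koszul K w = c := by
      have h1 := koszulOn_map (fun i => (X i : MvPolynomial (Fin n) K)) (fun i => X i)
        Finset.univ f g (fun i s u hi => by
          simp only [f, g, Finset.card_insert_of_notMem hi, Nat.add_right_cancel_iff]
          split_ifs
          · have e : d - (j : ℤ) = d - (j + 1 : ℕ) + 1 := by push_cast; ring
            rw [e, DegreeProjection.proj_X_smul]
          · simp) v
      refine h1.trans ?_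
      ext1 s
      have h2 : koszulOn (fun i => (X i : MvPolynomial (Fin n) K)) Finset.univ v = c := hv
      rw [h2]
      simp only [f]
      split_ifs with h
      · exact hcd s
      · rw [hcj s h]; rfl
    refine ⟨fun s => π (w s), fun s => ⟨_, rfl⟩, fun s hs => ?_, fun s => ?_, ?_, ?_⟩
    · simp [w, g, hs]
    · simp only [w, g]
      split_ifs
      · rw [← hπ, DegreeProjection.proj_proj]
      · simp
    · rw [koszul_comp, hw]
      ext s
      exact hcP s
    · rintro ⟨z, hzP, hz⟩
      choose y hy using hzP
      refine hb ⟨w - koszul K y, fun s => ?_, by rw [map_sub, koszul_koszul, hw, sub_zero]⟩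
      have h1 := congrFun (koszul_comp π y) s
      simp only [hy, hz] at h1
      rw [LinearMap.mem_ker, Pi.sub_apply, map_sub, ← h1, sub_self]

/-- The degrees of the minimal generators of a module are the degrees of its zeroth Koszul
homology. -/
lemma hasKoszulClass_range_zero_iff
    (hπ : ∀ d u, π ((freeProjection K n δ).proj d u) = G.proj d (π u))
    (hker : ∀ u, π u = 0 → ∀ k, constantCoeff (u k) = 0) (d : ℤ) :
    HasKoszulClass G (LinearMap.range π) 0 d ↔ ∃ k, (δ k : ℤ) = d := by
  constructor
  · rintro ⟨c, hcP, hcj, hcd, hcyc, hb⟩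
    by_contra! hd
    obtain ⟨v, hv⟩ := hcP ∅
    let u : Finset (Fin n) → Fin r → MvPolynomial (Fin n) K :=
      Pi.single ∅ ((freeProjection K n δ).proj d v)
    have hu0 : ∀ s : Finset (Fin n), s.card ≠ 0 → u s = 0 := fun s hs =>
      Pi.single_eq_of_ne (fun h => hs (by simp [h])) _
    -- The `k`-th coordinate has polynomial degree `d - δ k ≠ 0`, so it has no constant term and the
    -- lift is a boundary.
    obtain ⟨w, hw⟩ := koszul_exact_free u (koszul_eq_zero_of_card hu0) (fun k => by
      simp only [u, Pi.single_eq_same, freeProjection_apply]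
      exact constantCoeff_intComponent (fun h => hd k (by omega)) _)
    refine hb ⟨fun s => π (w s), fun s => ⟨_, rfl⟩, ?_⟩
    rw [koszul_comp, hw]
    ext s
    by_cases hs : s = ∅
    · subst hs
      have h := hcd ∅
      simp only [Nat.cast_zero, sub_zero] at h
      simp only [u, Pi.single_eq_same]
      rw [hπ, hv, h]
    · have hs' : s.card ≠ 0 := by simpa using hs
      rw [hu0 s hs', hcj s hs', map_zero]
  · rintro ⟨k, rfl⟩
    let c : Finset (Fin n) → N := Pi.single ∅ (π (Pi.single k 1))
    have hc0 : ∀ s : Finset (Fin n), s ≠ ∅ → c s = 0 := fun s hs => Pi.single_eq_of_ne hs _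
    have hce : c ∅ = π (Pi.single k 1) := Pi.single_eq_same _ _
    refine ⟨c, fun s => ?_, fun s hs => hc0 s (by simpa using hs), fun s => ?_,
      koszul_eq_zero_of_card fun s hs => hc0 s (by simpa using hs), ?_⟩
    · by_cases hs : s = ∅
      · exact ⟨_, by rw [hs, hce]⟩
      · rw [hc0 s hs]; exact zero_mem _
    · by_cases hs : s = ∅
      · rw [hs, hce, Nat.cast_zero, sub_zero, ← hπ, freeProjection_single]
      · rw [hc0 s hs, map_zero]
    · rintro ⟨w, hwP, hw⟩
      choose v hv using hwP
      have h1 := congrFun (koszul_comp π v) ∅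
      simp only [hv, hw, hce] at h1
      -- Boundaries have no constant terms, so the constant coefficient `1` of the basis vector
      -- would survive in an element of the kernel.
      have h2 := hker (Pi.single k 1 - koszul K v ∅) (by rw [map_sub, h1, sub_self]) k
      rw [Pi.sub_apply, map_sub, constantCoeff_koszul] at h2
      simp at h2

end KoszulModule

/-! ### Minimal graded free resolutions: basis degrees and existence -/

section Resolution

variable {K : Type*} [Field K] {n : ℕ}

lemma coeff_intComponent (d : ℤ) (p : MvPolynomial (Fin n) K) (m : Fin n →₀ ℕ) :
    coeff m (intComponent d p) = if (m.degree : ℤ) = d then coeff m p else 0 := by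
  rw [intComponent]
  split_ifs with h1 h2 h2
  · rw [coeff_homogeneousComponent, if_pos (by omega)]
  · rw [coeff_homogeneousComponent, if_neg (by omega)]
  · omega
  · rw [LinearMap.zero_apply, coeff_zero]

lemma map_freeProjection {r : ℕ} (δ : Fin r → ℕ)
    (π : (Fin r → MvPolynomial (Fin n) K) →ₗ[MvPolynomial (Fin n) K] MvPolynomial (Fin n) K)
    (b : ℕ) (hπ : ∀ k, π (Pi.single k 1) ≠ 0 → ∃ e : ℕ, δ k = b + e ∧
      (π (Pi.single k 1)).IsHomogeneous e) (d : ℤ) (u : Fin r → MvPolynomial (Fin n) K) :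
    π ((freeProjection K n δ).proj d u) = intComponent (d - b) (π u) := by
  rw [LinearMap.pi_apply_eq_sum_univ π, LinearMap.pi_apply_eq_sum_univ π u, map_sum]
  refine Finset.sum_congr rfl fun k _ => ?_
  have he : (fun j => if k = j then 1 else 0 : Fin r → MvPolynomial (Fin n) K) =
      Pi.single k 1 := by
    ext1 j; simp [Pi.single_apply, eq_comm]
  rw [he, freeProjection_apply, smul_eq_mul, smul_eq_mul]
  by_cases h0 : π (Pi.single k 1) = 0
  · simp [h0]
  · obtain ⟨e, he1, he2⟩ := hπ k h0
    rw [← intComponent_mul he2]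
    congr 2
    rw [he1]; push_cast; ring

lemma map_freeProjection_free {r s : ℕ} (δ : Fin r → ℕ) (ε : Fin s → ℕ)
    (π : (Fin r → MvPolynomial (Fin n) K) →ₗ[MvPolynomial (Fin n) K]
      (Fin s → MvPolynomial (Fin n) K))
    (hπ : ∀ k l, π (Pi.single k 1) l ≠ 0 → ∃ e : ℕ, δ k = ε l + e ∧
      (π (Pi.single k 1) l).IsHomogeneous e) (d : ℤ) (u : Fin r → MvPolynomial (Fin n) K) :
    π ((freeProjection K n δ).proj d u) = (freeProjection K n ε).proj d (π u) :=
  funext fun l => map_freeProjection δ (LinearMap.proj l ∘ₗ π) (ε l) (fun k => hπ k l) d u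

lemma constantCoeff_eq_zero_of_mem_range {r s : ℕ}
    (π : (Fin r → MvPolynomial (Fin n) K) →ₗ[MvPolynomial (Fin n) K]
      (Fin s → MvPolynomial (Fin n) K))
    (hπ : ∀ k l, constantCoeff (π (Pi.single k 1) l) = 0) {u : Fin s → MvPolynomial (Fin n) K}
    (hu : u ∈ Set.range π) (l : Fin s) : constantCoeff (u l) = 0 := by
  obtain ⟨v, rfl⟩ := hu
  rw [LinearMap.pi_apply_eq_sum_univ π v, Finset.sum_apply, map_sum]
  refine Finset.sum_eq_zero fun k _ => ?_
  have he : (fun j => if k = j then 1 else 0 : Fin r → MvPolynomial (Fin n) K) =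
      Pi.single k 1 := by
    ext1 j; simp [Pi.single_apply, eq_comm]
  rw [he, Pi.smul_apply, smul_eq_mul, map_mul, hπ, mul_zero]

namespace MinimalGradedFreeResolution

variable {I : Ideal (MvPolynomial (Fin n) K)} (F : MinimalGradedFreeResolution I)

include F in
lemma ker_aug_eq : LinearMap.ker F.aug = LinearMap.range (F.diff 0) :=
  LinearMap.exact_iff.mp F.exact_zero

lemma ker_diff_eq (j : ℕ) : LinearMap.ker (F.diff j) = LinearMap.range (F.diff (j + 1)) :=
  LinearMap.exact_iff.mp (F.exact_succ j)

lemma constantCoeff_of_aug_eq_zero {u} (hu : F.aug u = 0) (k) : constantCoeff (u k) = 0 :=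
  constantCoeff_eq_zero_of_mem_range (F.diff 0) (F.minimal 0) ((F.exact_zero u).mp hu) k

lemma constantCoeff_of_diff_eq_zero {j : ℕ} {u} (hu : F.diff j u = 0) (k) :
    constantCoeff (u k) = 0 :=
  constantCoeff_eq_zero_of_mem_range (F.diff (j + 1)) (F.minimal (j + 1))
    ((F.exact_succ j u).mp hu) k

lemma aug_freeProjection (d : ℤ) (u) : F.aug ((freeProjection K n (F.deg 0)).proj d u) =
    (polynomialProjection K n).proj d (F.aug u) := by
  have := map_freeProjection (F.deg 0) F.aug 0
    (fun k _ => ⟨_, (zero_add _).symm, F.aug_homogeneous k⟩) d u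
  rwa [Nat.cast_zero, sub_zero] at this

lemma hasKoszulClass_range_diff_iff (i j : ℕ) (d : ℤ) :
    HasKoszulClass (freeProjection K n (F.deg j)) (LinearMap.range (F.diff j)) i d ↔
      ∃ k, (F.deg (j + 1 + i) k : ℤ) = d := by
  induction i generalizing j with
  | zero =>
    exact hasKoszulClass_range_zero_iff _ _ _
      (map_freeProjection_free _ _ _ (F.diff_homogeneous j))
      (fun u hu => F.constantCoeff_of_diff_eq_zero hu) d
  | succ i ih =>
    rw [hasKoszulClass_range_succ_iff _ _ _
      (map_freeProjection_free _ _ _ (F.diff_homogeneous j))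
      (fun u hu => F.constantCoeff_of_diff_eq_zero hu) i d, ker_diff_eq, ih]
    rw [show j + 1 + (i + 1) = j + 1 + 1 + i by ring]

/-- The degrees of the basis elements of the `j`-th module in a minimal graded free resolution are
the degrees in which the `j`-th Koszul homology does not vanish. -/
lemma hasKoszulClass_iff (j : ℕ) (d : ℤ) :
    HasKoszulClass (polynomialProjection K n) I j d ↔ ∃ k, (F.deg j k : ℤ) = d := by
  conv_lhs => rw [← F.range_aug]
  cases j with
  | zero =>
    exact hasKoszulClass_range_zero_iff _ _ _ F.aug_freeProjection
      (fun u hu => F.constantCoeff_of_aug_eq_zero hu) d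
  | succ j =>
    rw [hasKoszulClass_range_succ_iff _ _ _ F.aug_freeProjection
      (fun u hu => F.constantCoeff_of_aug_eq_zero hu) j d, ker_aug_eq,
      hasKoszulClass_range_diff_iff, show 0 + 1 + j = j + 1 by ring]

end MinimalGradedFreeResolution

lemma sum_freeProjection {r : ℕ} (δ : Fin r → ℕ) (u : Fin r → MvPolynomial (Fin n) K) :
    ∃ D : ℕ, ∑ d ∈ Finset.range D, (freeProjection K n δ).proj (d : ℤ) u = u := by
  -- This bound exceeds every degree occurring in `u`, shifts included.
  refine ⟨∑ k, (δ k + (u k).totalDegree + 1), ?_⟩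
  ext k m
  simp only [Finset.sum_apply, freeProjection_apply, coeff_sum, coeff_intComponent]
  by_cases hm : coeff m (u k) = 0
  · simp [hm]
  rw [Finset.sum_eq_single (m.degree + δ k)]
  · rw [if_pos (by push_cast; ring)]
  · intro d _ hd
    rw [if_neg (by omega)]
  · intro h
    exfalso
    apply h
    have h1 : m.degree ≤ (u k).totalDegree := by
      have := le_totalDegree (mem_support_iff.mpr hm)
      rwa [Finsupp.degree_eq_sum, ← Finsupp.sum_fintype _ (fun _ e => e) (by simp)]
    have h2 := Finset.single_le_sum (f := fun k => δ k + (u k).totalDegree + 1)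
      (fun _ _ => Nat.zero_le _) (Finset.mem_univ k)
    rw [Finset.mem_range]
    omega

lemma exists_homogeneous_generators {r : ℕ} (δ : Fin r → ℕ)
    (P : Submodule (MvPolynomial (Fin n) K) (Fin r → MvPolynomial (Fin n) K))
    (hP : ∀ d, ∀ u ∈ P, (freeProjection K n δ).proj d u ∈ P) :
    ∃ (s : ℕ) (p : Fin s → Fin r → MvPolynomial (Fin n) K) (ε : Fin s → ℕ),
      (∀ k, (freeProjection K n δ).proj (ε k) (p k) = p k) ∧
        Submodule.span (MvPolynomial (Fin n) K) (Set.range p) = P := by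
  let S : Set (Fin r → MvPolynomial (Fin n) K) :=
    {u | u ∈ P ∧ ∃ d : ℕ, (freeProjection K n δ).proj d u = u}
  have hS : Submodule.span (MvPolynomial (Fin n) K) S = P := by
    refine le_antisymm (Submodule.span_le.mpr fun u hu => hu.1) fun u hu => ?_
    obtain ⟨D, hD⟩ := sum_freeProjection δ u
    rw [← hD]
    exact sum_mem fun d _ => Submodule.subset_span
      ⟨hP d u hu, d, DegreeProjection.proj_proj _ _ _⟩
  have hfg : (Submodule.span (MvPolynomial (Fin n) K) S).FG := IsNoetherian.noetherian _
  obtain ⟨T, hTS, hT⟩ := (Submodule.fg_span_iff_fg_span_finset_subset S).mp hfg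
  choose ε hε using fun k : Fin T.card => (hTS (T.equivFin.symm k).2).2
  refine ⟨T.card, fun k => T.equivFin.symm k, ε, hε, ?_⟩
  rw [← hS, hT]
  congr 1
  ext u
  constructor
  · rintro ⟨k, rfl⟩
    exact (T.equivFin.symm k).2
  · intro hu
    exact ⟨T.equivFin ⟨u, hu⟩, by simp⟩

/-- A graded submodule of a graded free module has a minimal graded free cover. -/
lemma exists_minimal_cover {r : ℕ} (δ : Fin r → ℕ)
    (P : Submodule (MvPolynomial (Fin n) K) (Fin r → MvPolynomial (Fin n) K))
    (hP : ∀ d, ∀ u ∈ P, (freeProjection K n δ).proj d u ∈ P) :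
    ∃ (s : ℕ) (ε : Fin s → ℕ) (π : (Fin s → MvPolynomial (Fin n) K) →ₗ[MvPolynomial (Fin n) K]
      (Fin r → MvPolynomial (Fin n) K)), LinearMap.range π = P ∧
      (∀ k l, π (Pi.single k 1) l ≠ 0 → ∃ e : ℕ, ε k = δ l + e ∧
        (π (Pi.single k 1) l).IsHomogeneous e) ∧
      (∀ u, π u = 0 → ∀ k, constantCoeff (u k) = 0) := by
  classical
  -- Minimality comes from taking the least possible number of homogeneous generators.
  have hex := exists_homogeneous_generators δ P hP
  obtain ⟨p, ε, hp, hspan⟩ := Nat.find_spec hex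
  have hmin := fun t (ht : t < Nat.find hex) => Nat.find_min hex ht
  generalize Nat.find hex = s at p ε hp hspan hmin
  have hπ : ∀ k l, Fintype.linearCombination (MvPolynomial (Fin n) K) p (Pi.single k 1) l ≠ 0 →
      ∃ e : ℕ, ε k = δ l + e ∧
        (Fintype.linearCombination (MvPolynomial (Fin n) K) p (Pi.single k 1) l).IsHomogeneous e := by
    intro k l hne
    rw [Fintype.linearCombination_apply_single, one_smul] at hne ⊢
    rcases exists_isHomogeneous_of_intComponent_eq (congrFun (hp k) l) with h | ⟨e, he, h⟩
    · exact absurd h hne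
    · exact ⟨e, by omega, h⟩
  refine ⟨s, ε, Fintype.linearCombination _ p, ?_, hπ, fun u hu k => ?_⟩
  · rw [Fintype.range_linearCombination, hspan]
  by_contra hk
  -- Projecting the relation to degree `ε k` turns the coefficient of `p k` into the nonzero
  -- constant `constantCoeff (u k)`, so `p k` is redundant, against the minimal choice of `s`.
  have hu' := map_freeProjection_free ε δ _ hπ (ε k) u
  rw [hu, map_zero] at hu'
  rw [Fintype.linearCombination_apply, ← Finset.add_sum_erase _ _ (Finset.mem_univ k)] at hu'
  cases s with
  | zero => exact k.elim0
  | succ s =>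
    refine hmin s (Nat.lt_succ_self s) ⟨fun i => p (k.succAbove i), fun i => ε (k.succAbove i),
      fun i => hp _, ?_⟩
    have hmem : ∀ i, i ≠ k → p i ∈ Submodule.span (MvPolynomial (Fin n) K)
        (Set.range fun i => p (k.succAbove i)) := fun i hi => by
      obtain ⟨i', rfl⟩ := Fin.exists_succAbove_eq hi
      exact Submodule.subset_span ⟨i', rfl⟩
    have hc : (freeProjection K n ε).proj (ε k) u k = C (constantCoeff (u k)) := by
      rw [freeProjection_apply, sub_self]
      exact (LinearMap.congr_fun (intComponent_natCast 0) _).trans (homogeneousComponent_zero _)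
    have hpk : p k ∈ Submodule.span (MvPolynomial (Fin n) K)
        (Set.range fun i => p (k.succAbove i)) := by
      have h1 : (C (constantCoeff (u k)) : MvPolynomial (Fin n) K) • p k ∈ Submodule.span (MvPolynomial (Fin n) K)
          (Set.range fun i => p (k.succAbove i)) := by
        rw [← hc, eq_neg_of_add_eq_zero_left hu']
        exact neg_mem (sum_mem fun i hi =>
          Submodule.smul_mem _ _ (hmem i (Finset.ne_of_mem_erase hi)))
      have h2 := Submodule.smul_mem _ (C (constantCoeff (u k))⁻¹ : MvPolynomial (Fin n) K) h1
      rwa [smul_smul, ← C_mul, inv_mul_cancel₀ hk, C_1, one_smul] at h2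
    rw [← hspan]
    refine le_antisymm (Submodule.span_mono ?_) (Submodule.span_le.mpr ?_)
    · rintro _ ⟨i, rfl⟩
      exact ⟨_, rfl⟩
    · rintro _ ⟨i, rfl⟩
      by_cases hi : i = k
      · exact hi ▸ hpk
      · exact hmem i hi

/-- A graded submodule of a graded free module of finite rank. -/
structure GradedSubmodule (K : Type*) [Field K] (n : ℕ) where
  /-- the rank of the ambient module -/
  rank : ℕ
  /-- the degrees of the basis of the ambient module -/
  deg : Fin rank → ℕ
  /-- the submodule -/
  carrier : Submodule (MvPolynomial (Fin n) K) (Fin rank → MvPolynomial (Fin n) K)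
  proj_mem : ∀ d, ∀ u ∈ carrier, (freeProjection K n deg).proj d u ∈ carrier

namespace GradedSubmodule

variable (P : GradedSubmodule K n)

/-- The rank of a minimal cover. -/
noncomputable def coverRank : ℕ := (exists_minimal_cover P.deg P.carrier P.proj_mem).choose

/-- The degrees of the basis of a minimal cover. -/
noncomputable def coverDeg : Fin P.coverRank → ℕ :=
  (exists_minimal_cover P.deg P.carrier P.proj_mem).choose_spec.choose

/-- A minimal cover. -/
noncomputable def cover : (Fin P.coverRank → MvPolynomial (Fin n) K) →ₗ[MvPolynomial (Fin n) K]
    (Fin P.rank → MvPolynomial (Fin n) K) :=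
  (exists_minimal_cover P.deg P.carrier P.proj_mem).choose_spec.choose_spec.choose

lemma range_cover : LinearMap.range P.cover = P.carrier :=
  (exists_minimal_cover P.deg P.carrier P.proj_mem).choose_spec.choose_spec.choose_spec.1

lemma cover_homogeneous : ∀ k l, P.cover (Pi.single k 1) l ≠ 0 →
    ∃ e : ℕ, P.coverDeg k = P.deg l + e ∧ (P.cover (Pi.single k 1) l).IsHomogeneous e :=
  (exists_minimal_cover P.deg P.carrier P.proj_mem).choose_spec.choose_spec.choose_spec.2.1

lemma constantCoeff_of_cover_eq_zero : ∀ u, P.cover u = 0 → ∀ k, constantCoeff (u k) = 0 :=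
  (exists_minimal_cover P.deg P.carrier P.proj_mem).choose_spec.choose_spec.choose_spec.2.2

/-- The first syzygy module. -/
noncomputable def syzygy : GradedSubmodule K n where
  rank := P.coverRank
  deg := P.coverDeg
  carrier := LinearMap.ker P.cover
  proj_mem d u hu := by
    rw [LinearMap.mem_ker, map_freeProjection_free _ _ _ P.cover_homogeneous, hu, map_zero]

/-- The iterated syzygy modules. -/
noncomputable def iterSyzygy : ℕ → GradedSubmodule K n
  | 0 => P
  | j + 1 => (iterSyzygy j).syzygy

lemma cover_exact (j : ℕ) :
    Function.Exact (P.iterSyzygy (j + 1)).cover (P.iterSyzygy j).cover :=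
  LinearMap.exact_iff.mpr (range_cover _).symm

/-- A homogeneous ideal as a graded submodule of the free module of rank one. -/
noncomputable def ofIdeal (I : Ideal (MvPolynomial (Fin n) K))
    (hI : I.IsHomogeneous (homogeneousSubmodule (Fin n) K)) : GradedSubmodule K n where
  rank := 1
  deg := fun _ => 0
  carrier := Submodule.comap (LinearMap.proj 0) I
  proj_mem d u hu := by
    rw [Submodule.mem_comap, LinearMap.proj_apply, freeProjection_apply, intComponent]
    split_ifs
    · exact homogeneousComponent_mem_of_mem hI hu _
    · exact zero_mem _

/-- The index of the basis element of the free module of rank one that contains an ideal. -/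
def ofIdealIndex (I : Ideal (MvPolynomial (Fin n) K))
    (hI : I.IsHomogeneous (homogeneousSubmodule (Fin n) K)) : Fin (ofIdeal I hI).rank :=
  (0 : Fin 1)

lemma eq_ofIdealIndex {I : Ideal (MvPolynomial (Fin n) K)}
    {hI : I.IsHomogeneous (homogeneousSubmodule (Fin n) K)} (k : Fin (ofIdeal I hI).rank) :
    k = ofIdealIndex I hI :=
  Subsingleton.elim (α := Fin 1) _ _

end GradedSubmodule

/-- Homogeneous ideals have minimal graded free resolutions. -/
noncomputable def minimalGradedFreeResolution (I : Ideal (MvPolynomial (Fin n) K))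
    (hI : I.IsHomogeneous (homogeneousSubmodule (Fin n) K)) : MinimalGradedFreeResolution I where
  rank j := ((GradedSubmodule.ofIdeal I hI).iterSyzygy j).coverRank
  deg j := ((GradedSubmodule.ofIdeal I hI).iterSyzygy j).coverDeg
  aug := LinearMap.proj (GradedSubmodule.ofIdealIndex I hI) ∘ₗ (GradedSubmodule.ofIdeal I hI).cover
  diff j := ((GradedSubmodule.ofIdeal I hI).iterSyzygy (j + 1)).cover
  range_aug := by
    refine le_antisymm ?_ fun x hx => ?_
    · rintro _ ⟨u, rfl⟩
      have h : (GradedSubmodule.ofIdeal I hI).cover u ∈ (GradedSubmodule.ofIdeal I hI).carrier :=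
        (GradedSubmodule.ofIdeal I hI).range_cover ▸ LinearMap.mem_range_self _ u
      exact h
    · have h : (fun _ => x) ∈ (GradedSubmodule.ofIdeal I hI).carrier := hx
      rw [← GradedSubmodule.range_cover] at h
      obtain ⟨u, hu⟩ := h
      exact ⟨u, congrFun hu (GradedSubmodule.ofIdealIndex I hI)⟩
  exact_zero u := by
    refine Iff.trans ?_ ((GradedSubmodule.ofIdeal I hI).cover_exact 0 u)
    constructor
    · intro h
      ext1 i
      rw [GradedSubmodule.eq_ofIdealIndex i]
      exact h
    · intro h
      exact congrFun h (GradedSubmodule.ofIdealIndex I hI)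
  exact_succ j := (GradedSubmodule.ofIdeal I hI).cover_exact (j + 1)
  aug_homogeneous k := by
    by_cases h : (GradedSubmodule.ofIdeal I hI).cover (Pi.single k 1)
        (GradedSubmodule.ofIdealIndex I hI) = 0
    · have h0 := isHomogeneous_zero (Fin n) K ((GradedSubmodule.ofIdeal I hI).coverDeg k)
      rw [← h] at h0
      exact h0
    · obtain ⟨e, he, h⟩ := (GradedSubmodule.ofIdeal I hI).cover_homogeneous k _ h
      have he' : (GradedSubmodule.ofIdeal I hI).coverDeg k = e := he.trans (zero_add e)
      rw [← he'] at h
      exact h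
  diff_homogeneous j := ((GradedSubmodule.ofIdeal I hI).iterSyzygy (j + 1)).cover_homogeneous
  minimal j k l := ((GradedSubmodule.ofIdeal I hI).iterSyzygy j).constantCoeff_of_cover_eq_zero _
    (((GradedSubmodule.ofIdeal I hI).cover_exact j _).mpr ⟨_, rfl⟩) l

end Resolution

/-! ### Degrees of a finitely generated multigraded module -/

section Cones

variable {K A M Γ ι : Type*} [Field K] [CommRing A] [Algebra K A] [AddCommGroup M] [Module K M]
  [Module A M] [IsScalarTower K A M] [AddCommMonoid Γ]

/-- Multiplication by monomials on a homogeneous element `u` with maximal annihilator modulo `N`. -/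
lemma monomial_smul_mem_or {y : ι → A} {δ : ι → Γ} {H : Γ → Set M}
    (hδ : ∀ g v, ∀ u ∈ H g, y v • u ∈ H (g + δ v)) {N N₁ : Submodule A M} {p : Γ} {u : M}
    (hu : u ∈ H p) (hu₁ : u ∈ N₁)
    (hmax : ∀ g, ∀ w ∈ H g, w ∈ N₁ → w ∉ N → (∀ a : A, a • u ∈ N → a • w ∈ N) →
      ∀ a : A, a • w ∈ N → a • u ∈ N) {z : A} (hz : z ∈ Submonoid.closure (Set.range y)) :
    z • u ∈ N ∨ ((∃ q ∈ AddSubmonoid.closure (δ '' {v | y v • u ∉ N}), z • u ∈ H (p + q)) ∧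
      ∀ a : A, a • z • u ∈ N → a • u ∈ N) := by
  induction hz using Submonoid.closure_induction_left with
  | one =>
    right
    exact ⟨⟨0, zero_mem _, by rwa [one_smul, add_zero]⟩, fun a ha => by rwa [one_smul] at ha⟩
  | mul_left x hx z _ ih =>
    obtain ⟨v, rfl⟩ := hx
    rcases ih with h | ⟨⟨q, hq, hzq⟩, hz⟩
    · left; rw [mul_smul]; exact N.smul_mem _ h
    by_cases hv : (y v * z) • u ∈ N
    · exact Or.inl hv
    right
    rw [mul_smul] at hv ⊢
    have hv' : y v • u ∉ N := fun h => hv (by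
      rw [smul_comm]; exact N.smul_mem _ h)
    refine ⟨⟨q + δ v, add_mem hq (AddSubmonoid.subset_closure ⟨v, hv', rfl⟩), ?_⟩, ?_⟩
    · rw [← add_assoc]
      exact hδ _ _ _ hzq
    -- A multiple of `u` has at least the annihilator of `u` modulo `N`; by maximality it has the
    -- same one as long as it stays outside `N`.
    · refine hmax _ _ (hδ _ v _ hzq) (N₁.smul_mem _ (N₁.smul_mem _ hu₁)) hv fun a ha => ?_
      rw [smul_comm a, smul_comm a]
      exact N.smul_mem _ (N.smul_mem _ ha)

/-- The annihilator of `u` modulo `N` behaves like a prime: a product of variables none of which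
sends `u` into `N` does not do so either. Hence every degree of the semigroup is attained. -/
lemma exists_monomial_smul_of_mem_closure {y : ι → A} {δ : ι → Γ} {H : Γ → Set M}
    (hδ : ∀ g v, ∀ u ∈ H g, y v • u ∈ H (g + δ v)) {N N₁ : Submodule A M} {p : Γ} {u : M}
    (hu : u ∈ H p) (hu₁ : u ∈ N₁) (huN : u ∉ N)
    (hmax : ∀ g, ∀ w ∈ H g, w ∈ N₁ → w ∉ N → (∀ a : A, a • u ∈ N → a • w ∈ N) →
      ∀ a : A, a • w ∈ N → a • u ∈ N) {q : Γ}
    (hq : q ∈ AddSubmonoid.closure (δ '' {v | y v • u ∉ N})) :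
    ∃ z : A, z • u ∈ H (p + q) ∧ z • u ∉ N ∧ ∀ a : A, a • z • u ∈ N → a • u ∈ N := by
  induction hq using AddSubmonoid.closure_induction_left with
  | zero => exact ⟨1, by simpa using hu, by simpa using huN, fun a ha => by simpa using ha⟩
  | add_left x hx q _ ih =>
    obtain ⟨v, hv, rfl⟩ := hx
    obtain ⟨z, hzH, hzN, hz⟩ := ih
    have hvz : (y v * z) • u ∉ N := fun h => hv (hz _ (by rwa [← mul_smul]))
    have hH : (y v * z) • u ∈ H (p + (δ v + q)) := by
      rw [mul_smul, add_comm (δ v), ← add_assoc]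
      exact hδ _ _ _ hzH
    refine ⟨y v * z, hH, hvz, hmax _ _ hH (N₁.smul_mem _ hu₁) hvz fun a ha => ?_⟩
    rw [smul_smul, mul_comm, mul_smul]
    exact N.smul_mem _ ha

/-- The set of degrees of a finitely generated multigraded module is a finite union of shifted
semigroups generated by degrees of variables. -/
theorem exists_cone_decomposition [IsNoetherianRing A] {y : ι → A}
    (hy : Algebra.adjoin K (Set.range y) = ⊤) {δ : ι → Γ} {H : Γ → Set M}
    (hδ : ∀ g v, ∀ u ∈ H g, y v • u ∈ H (g + δ v)) {proj : Γ → M →ₗ[K] M}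
    (hfix : ∀ g, ∀ u ∈ H g, proj g u = u) (hkill : ∀ g h, g ≠ h → ∀ u ∈ H h, proj g u = 0)
    {L : Type*} [AddCommGroup L] [Module A L] [IsNoetherian A L] (φ : L →ₗ[A] M)
    (N₁ : Submodule A M) (hφ : N₁ ≤ LinearMap.range φ) (N₀ : Submodule A M) (h₀₁ : N₀ ≤ N₁)
    (hproj : ∀ g, ∀ u ∈ N₀, proj g u ∈ N₀) :
    ∃ (b : ℕ) (p : Fin b → Γ) (V : Fin b → Set ι),
      (∀ g, (∃ u ∈ H g, u ∈ N₁ ∧ u ∉ N₀) ↔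
        ∃ k, ∃ q ∈ AddSubmonoid.closure (δ '' V k), g = p k + q) ∧
      ∀ k, ∀ v ∈ V k, ∃ u ∈ N₁, y v • u ∉ N₀ := by
  classical
  -- `M` itself need not be noetherian over `A`; `N₁` is, as it lies in the image of `L`. The
  -- induction runs upwards from `N₀` through the submodules of `N₁`.
  have hN₁ : IsNoetherian A N₁ := isNoetherian_of_le hφ
  have hwf : WellFounded fun (a b : Set.Iic N₁) => a > b :=
    (Submodule.mapIic N₁).symm.strictMono.wellFoundedGT.wf
  suffices h : ∀ N : Set.Iic N₁, (∀ g, ∀ u ∈ N.1, proj g u ∈ N.1) →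
      ∃ (b : ℕ) (p : Fin b → Γ) (V : Fin b → Set ι),
      (∀ g, (∃ u ∈ H g, u ∈ N₁ ∧ u ∉ N.1) ↔
        ∃ k, ∃ q ∈ AddSubmonoid.closure (δ '' V k), g = p k + q) ∧
      ∀ k, ∀ v ∈ V k, ∃ u ∈ N₁, y v • u ∉ N.1 from h ⟨N₀, h₀₁⟩ hproj
  intro N
  induction N using hwf.induction with
  | _ N ih =>
  obtain ⟨N, hN₁⟩ := N
  intro hN
  dsimp only at hN ⊢
  by_cases hex : ∃ g, ∃ u ∈ H g, u ∈ N₁ ∧ u ∉ N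
  swap
  · refine ⟨0, Fin.elim0, Fin.elim0, fun g => ⟨fun h => absurd ⟨g, h⟩ hex, ?_⟩, fun k => k.elim0⟩
    rintro ⟨k, -⟩
    exact k.elim0
  let S : Set (Ideal A) := {J | ∃ g, ∃ u ∈ H g, u ∈ N₁ ∧ u ∉ N ∧
    J = N.comap (LinearMap.toSpanSingleton A M u)}
  have hS : S.Nonempty := by
    obtain ⟨g, u, h1, h2, h3⟩ := hex
    exact ⟨_, g, u, h1, h2, h3, rfl⟩
  obtain ⟨_, ⟨p, u, hu, hu₁, huN, rfl⟩, hmax'⟩ := set_has_maximal_iff_noetherian.mpr ‹_› S hS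
  have hmax : ∀ g, ∀ w ∈ H g, w ∈ N₁ → w ∉ N → (∀ a : A, a • u ∈ N → a • w ∈ N) →
      ∀ a : A, a • w ∈ N → a • u ∈ N := by
    intro g w hw hw₁ hwN hle a ha
    by_contra hau
    refine hmax' _ ⟨g, w, hw, hw₁, hwN, rfl⟩ (lt_of_le_of_ne (fun a ha => hle a ha) fun h => ?_)
    have : a ∈ N.comap (LinearMap.toSpanSingleton A M u) := h ▸ ha
    exact hau this
  have hspan : ∀ s : A, s ∈ Submodule.span K (Submonoid.closure (Set.range y) : Set A) := by
    intro s
    rw [← Algebra.adjoin_eq_span, hy]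
    trivial
  -- Modulo `N`, the cyclic module generated by `u` lives only in degrees of the cone at `p`; enough
  -- to check this on monomials in the `y v`, which span `A` over `K`.
  have hprojsu : ∀ g, (¬ ∃ q ∈ AddSubmonoid.closure (δ '' {v | y v • u ∉ N}), g = p + q) →
      ∀ s : A, proj g (s • u) ∈ N := by
    intro g hg s
    induction hspan s using Submodule.span_induction with
    | mem z hz =>
      rcases monomial_smul_mem_or hδ hu hu₁ hmax hz with h | ⟨⟨q, hq, hzq⟩, -⟩
      · exact hN _ _ h
      · rw [hkill g (p + q) (fun h => hg ⟨q, hq, h⟩) _ hzq]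
        exact zero_mem _
    | zero => simp
    | add a b _ _ ha hb => rw [add_smul, map_add]; exact add_mem ha hb
    | smul c a _ ha =>
      rw [smul_assoc, map_smul, algebra_compatible_smul A]
      exact N.smul_mem _ ha
  set N' : Submodule A M := N ⊔ Submodule.span A {u} with hN'def
  have huN' : u ∈ N' := le_sup_right (a := N) (Submodule.mem_span_singleton_self u)
  have hNN' : N ≤ N' := le_sup_left
  have hN' : ∀ g, ∀ w ∈ N', proj g w ∈ N' := by
    intro g w hw
    obtain ⟨ν, hν, w', hw', rfl⟩ := Submodule.mem_sup.mp hw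
    obtain ⟨s, rfl⟩ := Submodule.mem_span_singleton.mp hw'
    rw [map_add]
    refine add_mem (hNN' (hN g ν hν)) ?_
    clear hw hw'
    induction hspan s using Submodule.span_induction with
    | mem z hz =>
      rcases monomial_smul_mem_or hδ hu hu₁ hmax hz with h | ⟨⟨q, hq, hzq⟩, -⟩
      · exact hNN' (hN _ _ h)
      · by_cases hg : g = p + q
        · subst hg
          rw [hfix _ _ hzq]
          exact N'.smul_mem _ huN'
        · rw [hkill g (p + q) hg _ hzq]
          exact zero_mem _
    | zero => simp
    | add a b _ _ ha hb => rw [add_smul, map_add]; exact add_mem ha hb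
    | smul c a _ ha =>
      rw [smul_assoc, map_smul, algebra_compatible_smul A]
      exact N'.smul_mem _ ha
  have hN'₁ : N' ≤ N₁ := sup_le hN₁ (by simpa using hu₁)
  obtain ⟨b, P, V, hPV, hV⟩ := ih ⟨N', hN'₁⟩
    (show N < N' from lt_of_le_of_ne hNN' fun h => huN (h ▸ huN')) hN'
  -- The step from `N` to `N' = N + Au` contributes one cone, with apex `p` and the variables that
  -- do not send `u` into `N`; the induction hypothesis handles the rest.
  refine ⟨b + 1, Fin.cons p P, Fin.cons {v | y v • u ∉ N} V, fun g => ?_, ?_⟩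
  · rw [Fin.exists_fin_succ]
    simp only [Fin.cons_zero, Fin.cons_succ]
    rw [← hPV]
    constructor
    · rintro ⟨w, hw, hw₁, hwN⟩
      by_cases hwN' : w ∈ N'
      · left
        by_contra hg
        obtain ⟨ν, hν, w', hw', rfl⟩ := Submodule.mem_sup.mp hwN'
        obtain ⟨s, rfl⟩ := Submodule.mem_span_singleton.mp hw'
        apply hwN
        rw [← hfix _ _ hw, map_add]
        exact add_mem (hN _ _ hν) (hprojsu g hg s)
      · exact Or.inr ⟨w, hw, hw₁, hwN'⟩
    · rintro (⟨q, hq, rfl⟩ | ⟨w, hw, hw₁, hwN⟩)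
      · obtain ⟨z, hzH, hzN, -⟩ :=
          exists_monomial_smul_of_mem_closure hδ hu hu₁ huN hmax hq
        exact ⟨_, hzH, N₁.smul_mem _ hu₁, hzN⟩
      · exact ⟨w, hw, hw₁, fun h => hwN (hNN' h)⟩
  · intro k
    refine Fin.cases ?_ (fun k => ?_) k
    · intro v hv
      exact ⟨u, hu₁, hv⟩
    · intro v hv
      obtain ⟨w, hw, h⟩ := hV k v hv
      exact ⟨w, hw, fun h' => h (hNN' h')⟩

end Cones

/-! ### From cones to linear functions -/

section LinearFunctions

variable {m b : ℕ} {g : Fin m → ℕ} {d : (i : Fin m) → Fin (g i) → ℕ}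

/-- The degree of the variable attached to a generator `f i l`. -/
def generatorDegree (d : (i : Fin m) → Fin (g i) → ℕ) (v : Σ i, Fin (g i)) : (Fin m → ℕ) × ℕ :=
  (Pi.single v.1 1, d v.1 v.2)

/-- A point of a cone over `a` uses exactly `a i - (p l).1 i` vectors of index `i`, so its height is
largest when each is the steepest one available. -/
lemma exists_linear_bounds_of_cones (p : Fin b → (Fin m → ℕ) × ℕ) (V : Fin b → Set (Σ i, Fin (g i))) :
    ∃ (b' : ℕ) (lam : Fin b' → Fin m → ℕ) (lam0 : Fin b' → ℤ) (c : Fin m → ℕ),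
      (∀ k i, lam k i ∈ Set.range (d i)) ∧ ∀ a : Fin m → ℕ, c ≤ a →
      (∀ k, ∃ e : ℕ, (∃ l, ∃ q ∈ AddSubmonoid.closure (generatorDegree d '' V l), (a, e) = p l + q) ∧
        (e : ℤ) = ∑ i, (lam k i : ℤ) * (a i : ℤ) + lam0 k) ∧
      (∀ e : ℕ, (∃ l, ∃ q ∈ AddSubmonoid.closure (generatorDegree d '' V l), (a, e) = p l + q) →
        ∃ k, (e : ℤ) ≤ ∑ i, (lam k i : ℤ) * (a i : ℤ) + lam0 k) := by
  classical
  -- Cones with a vector for every index; any other cone has a fixed `i`-th coordinate for some `i`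
  -- and is left behind by large `a`.
  let good : Finset (Fin b) := {l | ∀ i, ∃ v ∈ V l, v.1 = i}
  have hmax : ∀ l : good, ∀ i, ∃ v ∈ V l, v.1 = i ∧ ∀ w ∈ V l, w.1 = i → d w.1 w.2 ≤ d v.1 v.2 := by
    rintro ⟨l, hl⟩ i
    have hl' := (Finset.mem_filter.mp hl).2 i
    obtain ⟨v, ⟨hv, hvi⟩, hle⟩ := Set.exists_max_image {v | v ∈ V l ∧ v.1 = i}
      (fun v => d v.1 v.2) (Set.toFinite _) hl'
    exact ⟨v, hv, hvi, fun w hw hwi => hle w ⟨hw, hwi⟩⟩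
  choose v hvV hvi hvmax using hmax
  obtain ⟨D, hD⟩ : ∃ D : good → Fin m → ℕ, ∀ l i, D l i = d (v l i).1 (v l i).2 :=
    ⟨_, fun _ _ => rfl⟩
  obtain ⟨E, hE⟩ : ∃ E : good → ℤ, ∀ l, E l = (p l).2 - ∑ i, (D l i : ℤ) * ((p l).1 i : ℤ) :=
    ⟨_, fun _ => rfl⟩
  have hlin : ∀ (l : good) (a : Fin m → ℕ), (p l).1 ≤ a →
      (((p l).2 + ∑ i, (a i - (p l).1 i) * D l i : ℕ) : ℤ) =
      ∑ i, (D l i : ℤ) * (a i : ℤ) + E l := by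
    intro l a ha
    push_cast
    have : ∀ i, ((a i - (p l).1 i : ℕ) : ℤ) = a i - (p l).1 i := fun i => Nat.cast_sub (ha i)
    simp only [this, sub_mul, Finset.sum_sub_distrib, hE]
    simp only [mul_comm]
    ring
  refine ⟨good.card, fun k => D (good.equivFin.symm k), fun k => E (good.equivFin.symm k),
    -- The threshold strictly exceeds every apex coordinate; strictness is what excludes the cones
    -- outside `good`.
    fun i => ∑ l, ((p l).1 i + 1), ?_, ?_⟩
  · intro k i
    have h := hvi (good.equivFin.symm k) i
    beta_reduce
    rw [hD]
    generalize v (good.equivFin.symm k) i = w at h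
    obtain ⟨i', l⟩ := w
    subst h
    exact ⟨l, rfl⟩
  intro a ha
  have hpa : ∀ l i, (p l).1 i < a i := fun l i => by
    have h1 := Finset.single_le_sum (f := fun l => (p l).1 i + 1)
      (fun _ _ => Nat.zero_le _) (Finset.mem_univ l)
    exact lt_of_lt_of_le (Nat.lt_succ_self _) (h1.trans (ha i))
  constructor
  · intro k
    beta_reduce
    generalize good.equivFin.symm k = l
    refine ⟨_, ⟨l, ∑ i, (a i - (p l).1 i) • generatorDegree d (v l i), ?_, ?_⟩,
      hlin l a fun i => (hpa l i).le⟩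
    · exact sum_mem fun i _ => nsmul_mem (AddSubmonoid.subset_closure (Set.mem_image_of_mem _ (hvV l i))) _
    · refine Prod.ext ?_ ?_
      · ext i
        simp only [generatorDegree, Prod.fst_add, Prod.fst_sum, Pi.add_apply, Finset.sum_apply,
          Prod.smul_mk, Pi.smul_apply, hvi, smul_eq_mul]
        rw [Finset.sum_eq_single i]
        · have := hpa l i
          simp only [Pi.single_eq_same]
          omega
        · intro i' _ h
          rw [Pi.single_eq_of_ne h.symm, mul_zero]
        · simp
      · simp [generatorDegree, Prod.snd_sum, hD]
  · rintro e ⟨l, q, hq, hae⟩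
    have ha1 : ∀ i, a i = (p l).1 i + q.1 i := fun i => congrFun (congrArg Prod.fst hae) i
    have he : e = (p l).2 + q.2 := congrArg Prod.snd hae
    have hl : l ∈ good := by
      refine Finset.mem_filter.mpr ⟨Finset.mem_univ _, fun i => ?_⟩
      by_contra! hi
      have hq0 : q.1 i = 0 := by
        clear hae ha1 he
        induction hq using AddSubmonoid.closure_induction with
        | mem x hx =>
          obtain ⟨w, hw, rfl⟩ := hx
          exact Pi.single_eq_of_ne (hi w hw).symm _
        | zero => rfl
        | add x y _ _ hx hy => rw [Prod.fst_add, Pi.add_apply, hx, hy]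
      have := ha1 i
      have := hpa l i
      omega
    refine ⟨good.equivFin ⟨l, hl⟩, ?_⟩
    simp only [Equiv.symm_apply_apply]
    rw [← hlin ⟨l, hl⟩ a fun i => (hpa l i).le, he]
    have hq2 : q.2 ≤ ∑ i, q.1 i * D ⟨l, hl⟩ i := by
      clear hae ha1 he
      induction hq using AddSubmonoid.closure_induction with
      | mem x hx =>
        obtain ⟨w, hw, rfl⟩ := hx
        rw [Finset.sum_eq_single w.1]
        · simpa [generatorDegree, hD] using hvmax ⟨l, hl⟩ w.1 w hw rfl
        · intro i _ hi
          simp [generatorDegree, Pi.single_eq_of_ne hi]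
        · simp
      | zero => simp
      | add x y _ _ hx hy =>
        simp only [Prod.fst_add, Prod.snd_add, Pi.add_apply, add_mul, Finset.sum_add_distrib]
        exact add_le_add hx hy
    have : ∀ i, a i - (p l).1 i = q.1 i := fun i => by rw [ha1 i]; omega
    simp only [this]
    exact_mod_cast Nat.add_le_add_left hq2 _

end LinearFunctions

/-! ### Koszul homology of the multi-Rees algebra -/

section ReesAlgebra

variable {K : Type*} [Field K] {n m : ℕ} {g : Fin m → ℕ}

/-- The generators of the multi-Rees algebra over `K`. -/
noncomputable def reesGenerator (f : (i : Fin m) → Fin (g i) → MvPolynomial (Fin n) K) :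
    Fin n ⊕ (Σ i, Fin (g i)) → MvPolynomial (Fin m) (MvPolynomial (Fin n) K)
  | .inl i => C (X i)
  | .inr v => monomial (Finsupp.single v.1 1) (f v.1 v.2)

/-- The multi-Rees algebra `⨁ I_1^{a_1} ⋯ I_m^{a_m}` of the ideals `I_i = (f i 1, f i 2, …)`. -/
noncomputable def multiRees (f : (i : Fin m) → Fin (g i) → MvPolynomial (Fin n) K) :
    Subalgebra K (MvPolynomial (Fin m) (MvPolynomial (Fin n) K)) :=
  Algebra.adjoin K (Set.range (reesGenerator f))

variable (f : (i : Fin m) → Fin (g i) → MvPolynomial (Fin n) K)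

/-- The generators as elements of the multi-Rees algebra. -/
noncomputable def multiRees.gen (v : Fin n ⊕ (Σ i, Fin (g i))) : multiRees f :=
  ⟨reesGenerator f v, Algebra.subset_adjoin ⟨v, rfl⟩⟩

lemma multiRees.adjoin_gen : Algebra.adjoin K (Set.range (multiRees.gen f)) = ⊤ := by
  have h : Set.range (multiRees.gen f) =
      (Subtype.val : multiRees f → _) ⁻¹' (Set.range (reesGenerator f)) := by
    ext x
    constructor
    · rintro ⟨v, rfl⟩; exact ⟨v, rfl⟩
    · rintro ⟨v, hv⟩; exact ⟨v, Subtype.ext hv⟩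
  rw [h]
  exact Algebra.adjoin_adjoin_coe_preimage

instance multiRees.isNoetherianRing : IsNoetherianRing (multiRees f) := by
  refine isNoetherianRing_of_fg ⟨(Set.finite_range (reesGenerator f)).toFinset, ?_⟩
  rw [Set.Finite.coe_toFinset, multiRees]

lemma C_mem_multiRees (u : MvPolynomial (Fin n) K) :
    (C u : MvPolynomial (Fin m) (MvPolynomial (Fin n) K)) ∈ multiRees f := by
  induction u using MvPolynomial.induction_on with
  | C a => exact (multiRees f).algebraMap_mem a
  | add p q hp hq => rw [C_add]; exact add_mem hp hq
  | mul_X p i hp => rw [C_mul]; exact mul_mem hp (Algebra.subset_adjoin ⟨.inl i, rfl⟩)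

lemma mem_prod_pow_zero (I : Fin m → Ideal (MvPolynomial (Fin n) K)) (u : MvPolynomial (Fin n) K) :
    u ∈ ∏ i, I i ^ (0 : Fin m →₀ ℕ) i := by
  have h : ∏ i, I i ^ (0 : Fin m →₀ ℕ) i = ⊤ :=
    (Finset.prod_eq_one fun i _ => pow_zero (I i)).trans Ideal.one_eq_top
  rw [h]
  trivial

/-- The exponents `a` with this property are closed under addition, which leaves `a = 0` and the
unit vectors. -/
lemma monomial_mem_multiRees (a : Fin m →₀ ℕ) : ∀ u ∈ ∏ i, Ideal.span (Set.range (f i)) ^ a i,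
    (monomial a u : MvPolynomial (Fin m) (MvPolynomial (Fin n) K)) ∈ multiRees f := by
  have hadd : ∀ a b : Fin m →₀ ℕ,
      (∀ u ∈ ∏ i, Ideal.span (Set.range (f i)) ^ a i, monomial a u ∈ multiRees f) →
      (∀ u ∈ ∏ i, Ideal.span (Set.range (f i)) ^ b i, monomial b u ∈ multiRees f) →
      ∀ u ∈ ∏ i, Ideal.span (Set.range (f i)) ^ (a + b) i, monomial (a + b) u ∈ multiRees f := by
    intro a b ha hb u hu
    simp only [Finsupp.add_apply, pow_add, Finset.prod_mul_distrib] at hu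
    induction hu using Submodule.mul_induction_on' with
    | mem_mul_mem v hv w hw =>
      rw [← monomial_mul]
      exact mul_mem (ha v hv) (hb w hw)
    | add v _ w _ hv hw => rw [map_add]; exact add_mem hv hw
  have hzero : ∀ u ∈ ∏ i, Ideal.span (Set.range (f i)) ^ (0 : Fin m →₀ ℕ) i,
      monomial 0 u ∈ multiRees f := fun u _ => C_mem_multiRees f u
  induction a using Finsupp.induction_linear with
  | zero => exact hzero
  | add a b ha hb => exact hadd a b ha hb
  | single i k =>
    induction k with
    | zero => rw [Finsupp.single_zero]; exact hzero
    | succ k ih =>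
      rw [Finsupp.single_add]
      refine hadd _ _ ih fun u hu => ?_
      rw [Finset.prod_eq_single i (fun l _ hl => by
        rw [Finsupp.single_eq_of_ne hl, pow_zero]) (fun h => absurd (Finset.mem_univ i) h),
        Finsupp.single_eq_same, pow_one] at hu
      induction hu using Submodule.span_induction with
      | mem u hu =>
        obtain ⟨l, rfl⟩ := hu
        exact Algebra.subset_adjoin ⟨.inr ⟨i, l⟩, rfl⟩
      | zero => rw [map_zero]; exact zero_mem _
      | add u v _ _ hu hv => rw [map_add]; exact add_mem hu hv
      | smul r u _ hu =>
        rw [smul_eq_mul, ← C_mul_monomial]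
        exact mul_mem (C_mem_multiRees f r) hu

/-- The multi-Rees algebra consists of the polynomials whose coefficients lie in the products of
powers of the ideals. -/
lemma mem_multiRees_iff (p : MvPolynomial (Fin m) (MvPolynomial (Fin n) K)) :
    p ∈ multiRees f ↔ ∀ a : Fin m →₀ ℕ, coeff a p ∈ ∏ i, Ideal.span (Set.range (f i)) ^ a i := by
  classical
  constructor
  · intro hp
    induction hp using Algebra.adjoin_induction with
    | mem x hx =>
      intro a
      obtain ⟨i | v, rfl⟩ := hx
      · simp only [reesGenerator, coeff_C]
        split_ifs with h
        · subst h; exact mem_prod_pow_zero _ _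
        · exact zero_mem _
      · simp only [reesGenerator, coeff_monomial]
        split_ifs with h
        · subst h
          rw [Finset.prod_eq_single v.1 (fun l _ hl => by
            rw [Finsupp.single_eq_of_ne hl, pow_zero]) (fun h => absurd (Finset.mem_univ v.1) h),
            Finsupp.single_eq_same, pow_one]
          exact Ideal.subset_span ⟨v.2, rfl⟩
        · exact zero_mem _
    | algebraMap r =>
      intro a
      rw [MvPolynomial.algebraMap_apply, coeff_C]
      split_ifs with h
      · subst h; exact mem_prod_pow_zero _ _
      · exact zero_mem _
    | add x y _ _ hx hy => intro a; rw [coeff_add]; exact add_mem (hx a) (hy a)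
    | mul x y _ _ hx hy =>
      intro a
      rw [coeff_mul]
      refine sum_mem fun b hb => ?_
      rw [← Finset.HasAntidiagonal.mem_antidiagonal.mp hb]
      simp only [Finsupp.add_apply, pow_add, Finset.prod_mul_distrib]
      exact Ideal.mul_mem_mul (hx _) (hy _)
  · intro h
    rw [p.as_sum]
    exact sum_mem fun a _ => monomial_mem_multiRees f a _ (h a)

/-- The Koszul differential of `R[t_1, …, t_m]` with respect to the variables of `R`. -/
noncomputable def reesKoszul (K : Type*) [Field K] (n m : ℕ) :
    (Finset (Fin n) → MvPolynomial (Fin m) (MvPolynomial (Fin n) K))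
      →ₗ[MvPolynomial (Fin m) (MvPolynomial (Fin n) K)]
    (Finset (Fin n) → MvPolynomial (Fin m) (MvPolynomial (Fin n) K)) :=
  koszulOn (fun i => C (X i)) Finset.univ

/-- Koszul chains with values in the multi-Rees algebra. -/
noncomputable def reesChains :
    Submodule (multiRees f) (Finset (Fin n) → MvPolynomial (Fin m) (MvPolynomial (Fin n) K)) :=
  LinearMap.range ((Algebra.linearMap (multiRees f)
    (MvPolynomial (Fin m) (MvPolynomial (Fin n) K))).compLeft (Finset (Fin n)))

lemma mem_reesChains {c : Finset (Fin n) → MvPolynomial (Fin m) (MvPolynomial (Fin n) K)} :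
    c ∈ reesChains f ↔ ∀ s, c s ∈ multiRees f := by
  constructor
  · rintro ⟨c, rfl⟩ s
    exact (c s).2
  · intro h
    exact ⟨fun s => ⟨c s, h s⟩, rfl⟩

/-- Koszul cycles with values in the multi-Rees algebra. -/
noncomputable def reesCycles :
    Submodule (multiRees f) (Finset (Fin n) → MvPolynomial (Fin m) (MvPolynomial (Fin n) K)) :=
  reesChains f ⊓ LinearMap.ker ((reesKoszul K n m).restrictScalars (multiRees f))

/-- Koszul boundaries with values in the multi-Rees algebra. -/
noncomputable def reesBoundaries :
    Submodule (multiRees f) (Finset (Fin n) → MvPolynomial (Fin m) (MvPolynomial (Fin n) K)) :=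
  (reesChains f).map ((reesKoszul K n m).restrictScalars (multiRees f))

lemma mem_reesCycles {c : Finset (Fin n) → MvPolynomial (Fin m) (MvPolynomial (Fin n) K)} :
    c ∈ reesCycles f ↔ (∀ s, c s ∈ multiRees f) ∧ reesKoszul K n m c = 0 := by
  rw [reesCycles, Submodule.mem_inf, mem_reesChains]; rfl

lemma mem_reesBoundaries {c : Finset (Fin n) → MvPolynomial (Fin m) (MvPolynomial (Fin n) K)} :
    c ∈ reesBoundaries f ↔ ∃ w : Finset (Fin n) → MvPolynomial (Fin m) (MvPolynomial (Fin n) K),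
      (∀ s, w s ∈ multiRees f) ∧ reesKoszul K n m w = c := by
  simp only [← mem_reesChains]; rfl

lemma reesBoundaries_le_reesCycles : reesBoundaries f ≤ reesCycles f := by
  intro c hc
  obtain ⟨w, hw, rfl⟩ := (mem_reesBoundaries f).mp hc
  refine (mem_reesCycles f).mpr ⟨fun s => ?_, koszulOn_koszulOn _ _ w⟩
  rw [reesKoszul, koszulOn_apply_apply]
  refine sum_mem fun i _ => ?_
  split_ifs
  · exact zero_mem _
  · exact zsmul_mem (mul_mem (C_mem_multiRees f _) (hw _)) _

/-- The degrees of the generators of the multi-Rees algebra. -/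
def reesDegree (d : (i : Fin m) → Fin (g i) → ℕ) :
    Fin n ⊕ (Σ i, Fin (g i)) → (Fin m → ℕ) × ℕ
  | .inl _ => (0, 1)
  | .inr v => generatorDegree d v

/-- Homogeneous Koszul chains of homological degree `j`. -/
def homogeneousChains (K : Type*) [Field K] (n m j : ℕ) (γ : (Fin m → ℕ) × ℕ) :
    Set (Finset (Fin n) → MvPolynomial (Fin m) (MvPolynomial (Fin n) K)) :=
  {c | ∃ r : Finset (Fin n) → MvPolynomial (Fin n) K,
    (∀ s, c s = monomial (Finsupp.equivFunOnFinite.symm γ.1) (r s)) ∧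
    (∀ s, s.card ≠ j → r s = 0) ∧ ∀ s, intComponent (γ.2 - j) (r s) = r s}

/-- The projection of Koszul chains to their component of a given degree. -/
noncomputable def chainProjection (K : Type*) [Field K] (n m : ℕ) (γ : (Fin m → ℕ) × ℕ) :
    (Finset (Fin n) → MvPolynomial (Fin m) (MvPolynomial (Fin n) K)) →ₗ[K]
      (Finset (Fin n) → MvPolynomial (Fin m) (MvPolynomial (Fin n) K)) :=
  LinearMap.pi fun s =>
    (monomial (R := MvPolynomial (Fin n) K)
        (Finsupp.equivFunOnFinite.symm γ.1)).restrictScalars K ∘ₗ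
      intComponent (γ.2 - s.card) ∘ₗ
      (lcoeff (MvPolynomial (Fin n) K) (Finsupp.equivFunOnFinite.symm γ.1)).restrictScalars K ∘ₗ
      LinearMap.proj s

lemma chainProjection_apply (γ : (Fin m → ℕ) × ℕ)
    (c : Finset (Fin n) → MvPolynomial (Fin m) (MvPolynomial (Fin n) K)) (s : Finset (Fin n)) :
    chainProjection K n m γ c s = monomial (Finsupp.equivFunOnFinite.symm γ.1)
      (intComponent (γ.2 - s.card) (coeff (Finsupp.equivFunOnFinite.symm γ.1) (c s))) := rfl

lemma intComponent_intComponent_of_ne {d e : ℤ} (h : d ≠ e) (p : MvPolynomial (Fin n) K) :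
    intComponent d (intComponent e p) = 0 := by
  ext m
  rw [coeff_intComponent, coeff_intComponent, coeff_zero]
  split_ifs with h1 h2
  · exact absurd (h1.symm.trans h2) h
  · rfl
  · rfl

lemma chainProjection_eq_self {j : ℕ} (γ : (Fin m → ℕ) × ℕ) :
    ∀ c ∈ homogeneousChains K n m j γ, chainProjection K n m γ c = c := by
  rintro c ⟨r, hc, hj, hr⟩
  ext1 s
  rw [chainProjection_apply, hc, coeff_monomial, if_pos rfl]
  by_cases hs : s.card = j
  · rw [hs, hr]
  · rw [hj s hs, map_zero]

lemma chainProjection_eq_zero {j : ℕ} (γ γ' : (Fin m → ℕ) × ℕ) (h : γ ≠ γ') :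
    ∀ c ∈ homogeneousChains K n m j γ', chainProjection K n m γ c = 0 := by
  rintro c ⟨r, hc, hj, hr⟩
  ext1 s
  rw [chainProjection_apply, hc, coeff_monomial]
  split_ifs with h1
  · have h2 : γ.2 ≠ γ'.2 := fun h2 =>
      h (Prod.ext (Finsupp.equivFunOnFinite.symm.injective h1.symm) h2)
    by_cases hs : s.card = j
    · rw [hs, ← hr, intComponent_intComponent_of_ne (by omega), map_zero]; rfl
    · rw [hj s hs, map_zero, map_zero]; rfl
  · rw [map_zero, map_zero]; rfl

lemma gen_smul_mem_homogeneousChains {d : (i : Fin m) → Fin (g i) → ℕ}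
    (hf : ∀ i l, (f i l).IsHomogeneous (d i l)) {j : ℕ} (γ : (Fin m → ℕ) × ℕ)
    (v : Fin n ⊕ (Σ i, Fin (g i))) : ∀ c ∈ homogeneousChains K n m j γ,
      multiRees.gen f v • c ∈ homogeneousChains K n m j (γ + reesDegree d v) := by
  classical
  rintro c ⟨r, hc, hj, hr⟩
  have key : ∀ (q : MvPolynomial (Fin n) K) (e : ℕ), q.IsHomogeneous e → ∀ s,
      intComponent ((γ.2 + e : ℕ) - j : ℤ) (q * r s) = q * r s := fun q e hq s => by
    have := intComponent_mul hq (γ.2 - j) (r s)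
    rw [hr, mul_comm] at this
    rwa [show ((γ.2 + e : ℕ) - j : ℤ) = γ.2 - j + e by push_cast; ring]
  cases v with
  | inl i =>
    refine ⟨fun s => X i * r s, fun s => ?_, fun s hs => by simp [hj s hs], fun s =>
      key _ 1 (isHomogeneous_X K i) s⟩
    have h : (multiRees.gen f (.inl i) • c) s = C (X i) * c s := rfl
    rw [h, hc, C_mul_monomial]
    simp [reesDegree]
  | inr v =>
    refine ⟨fun s => f v.1 v.2 * r s, fun s => ?_, fun s hs => by simp [hj s hs], fun s =>
      key _ _ (hf v.1 v.2) s⟩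
    have h : (multiRees.gen f (.inr v) • c) s =
      monomial (Finsupp.single v.1 1) (f v.1 v.2) * c s := rfl
    have hdeg : Finsupp.single v.1 1 + Finsupp.equivFunOnFinite.symm γ.1 =
        Finsupp.equivFunOnFinite.symm (γ + reesDegree (n := n) d (.inr v)).1 := by
      ext i
      simp [reesDegree, generatorDegree, Finsupp.single_apply, Pi.single_apply, add_comm, eq_comm]
    rw [h, hc, monomial_mul, hdeg]

lemma prod_pow_isHomogeneous {I : Fin m → Ideal (MvPolynomial (Fin n) K)}
    (hI : ∀ i, (I i).IsHomogeneous (homogeneousSubmodule (Fin n) K)) (a : Fin m → ℕ) :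
    (∏ i, I i ^ a i).IsHomogeneous (homogeneousSubmodule (Fin n) K) := by
  have hone : (1 : Ideal (MvPolynomial (Fin n) K)).IsHomogeneous
      (homogeneousSubmodule (Fin n) K) := by
    rw [Ideal.one_eq_top]; exact Ideal.IsHomogeneous.top _
  refine Finset.prod_induction _ (fun J : Ideal (MvPolynomial (Fin n) K) => J.IsHomogeneous (homogeneousSubmodule (Fin n) K))
    (fun _ _ h1 h2 => h1.mul h2) hone fun i _ => ?_
  induction a i with
  | zero => rw [pow_zero]; exact hone
  | succ k ih => rw [pow_succ]; exact ih.mul (hI i)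

/-- The projection uses `s.card` rather than a fixed homological degree, so it commutes with the
Koszul differential; it preserves chains of the Rees algebra because the products of powers are
homogeneous. -/
lemma chainProjection_mem_reesBoundaries
    (hI : ∀ i, (Ideal.span (Set.range (f i))).IsHomogeneous (homogeneousSubmodule (Fin n) K))
    (γ : (Fin m → ℕ) × ℕ) :
    ∀ c ∈ reesBoundaries f, chainProjection K n m γ c ∈ reesBoundaries f := by
  intro c hc
  obtain ⟨w, hw, rfl⟩ := (mem_reesBoundaries f).mp hc
  refine (mem_reesBoundaries f).mpr ⟨chainProjection K n m γ w, fun s => ?_, ?_⟩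
  · rw [chainProjection_apply]
    refine monomial_mem_multiRees f _ _ ?_
    rw [intComponent]
    split_ifs
    · exact homogeneousComponent_mem_of_mem (prod_pow_isHomogeneous hI _)
        ((mem_multiRees_iff f _).mp (hw s) _) _
    · exact zero_mem _
  · let φ : Finset (Fin n) → MvPolynomial (Fin m) (MvPolynomial (Fin n) K) →+
        MvPolynomial (Fin m) (MvPolynomial (Fin n) K) := fun s =>
      ((monomial (R := MvPolynomial (Fin n) K)
        (Finsupp.equivFunOnFinite.symm γ.1)).restrictScalars K ∘ₗ intComponent (γ.2 - s.card) ∘ₗ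
      (lcoeff (MvPolynomial (Fin n) K)
        (Finsupp.equivFunOnFinite.symm γ.1)).restrictScalars K).toAddMonoidHom
    refine koszulOn_map _ _ Finset.univ φ φ (fun i s u hi => ?_) w
    change monomial _ (intComponent (γ.2 - s.card) (coeff _ (C (X i) * u))) =
      C (X i) * monomial _ (intComponent (γ.2 - (insert i s).card) (coeff _ u))
    rw [coeff_C_mul, C_mul_monomial, Finset.card_insert_of_notMem hi]
    have := intComponent_mul (isHomogeneous_X K i) (γ.2 - (s.card + 1 : ℕ))
      (coeff (Finsupp.equivFunOnFinite.symm γ.1) u)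
    rw [mul_comm, mul_comm _ (X i)] at this
    rw [← this, show (γ.2 - (s.card + 1 : ℕ) + (1 : ℕ) : ℤ) = γ.2 - s.card by push_cast; ring]

/-- Koszul homology of the products of powers are the graded pieces of the Koszul homology of the
multi-Rees algebra. -/
lemma exists_homogeneousChains_iff (j : ℕ) (γ : (Fin m → ℕ) × ℕ) :
    (∃ c ∈ homogeneousChains K n m j γ, c ∈ reesCycles f ∧ c ∉ reesBoundaries f) ↔
      HasKoszulClass (polynomialProjection K n) (∏ i, Ideal.span (Set.range (f i)) ^ γ.1 i) j
        (γ.2 : ℤ) := by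
  have hmono (r : Finset (Fin n) → MvPolynomial (Fin n) K) (a : Fin m →₀ ℕ) :
      reesKoszul K n m (fun s => monomial a (r s)) = fun s => monomial a (koszul K r s) :=
    koszulOn_map (fun i => (X i : MvPolynomial (Fin n) K))
      (fun i => (C (X i) : MvPolynomial (Fin m) (MvPolynomial (Fin n) K))) Finset.univ
      (fun _ => (monomial (R := MvPolynomial (Fin n) K) a).toAddMonoidHom)
      (fun _ => (monomial (R := MvPolynomial (Fin n) K) a).toAddMonoidHom)
      (fun i s u _ => (C_mul_monomial (R := MvPolynomial (Fin n) K)).symm) r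
  have hcoeff (c : Finset (Fin n) → MvPolynomial (Fin m) (MvPolynomial (Fin n) K))
      (a : Fin m →₀ ℕ) :
      koszul K (fun s => coeff a (c s)) = fun s => coeff a (reesKoszul K n m c s) :=
    koszulOn_map (fun i => (C (X i) : MvPolynomial (Fin m) (MvPolynomial (Fin n) K)))
      (fun i => (X i : MvPolynomial (Fin n) K)) Finset.univ
      (fun _ => (lcoeff (MvPolynomial (Fin n) K) a).toAddMonoidHom)
      (fun _ => (lcoeff (MvPolynomial (Fin n) K) a).toAddMonoidHom)
      (fun i s u _ => by
        change coeff a (C (X i) * u) = X i * coeff a u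
        exact coeff_C_mul a _ u) c
  constructor
  · rintro ⟨c, ⟨r, hc, hj, hr⟩, hcyc, hb⟩
    obtain ⟨hcR, hcyc⟩ := (mem_reesCycles f).mp hcyc
    have hcr : ∀ s, coeff (Finsupp.equivFunOnFinite.symm γ.1) (c s) = r s := fun s => by
      rw [hc, coeff_monomial, if_pos rfl]
    refine ⟨r, fun s => ?_, hj, hr, ?_, ?_⟩
    · rw [← hcr]
      exact (mem_multiRees_iff f _).mp (hcR s) (Finsupp.equivFunOnFinite.symm γ.1)
    · have := hcoeff c (Finsupp.equivFunOnFinite.symm γ.1)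
      simp only [hcr, hcyc] at this
      rw [this]
      ext1 s
      exact coeff_zero _
    · rintro ⟨w, hw, hwr⟩
      refine hb ((mem_reesBoundaries f).mpr
        ⟨fun s => monomial (Finsupp.equivFunOnFinite.symm γ.1) (w s),
          fun s => monomial_mem_multiRees f _ _ (hw s), ?_⟩)
      rw [hmono, hwr]
      exact funext fun s => (hc s).symm
  · rintro ⟨r, hrP, hj, hr, hcyc, hb⟩
    refine ⟨fun s => monomial (Finsupp.equivFunOnFinite.symm γ.1) (r s),
      ⟨r, fun s => rfl, hj, hr⟩, (mem_reesCycles f).mpr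
        ⟨fun s => monomial_mem_multiRees f _ _ (hrP s), ?_⟩, fun h => ?_⟩
    · rw [hmono, hcyc]
      exact funext fun s => map_zero _
    · obtain ⟨w, hw, hwr⟩ := (mem_reesBoundaries f).mp h
      refine hb ⟨fun s => coeff (Finsupp.equivFunOnFinite.symm γ.1) (w s),
        fun s => (mem_multiRees_iff f _).mp (hw s) (Finsupp.equivFunOnFinite.symm γ.1), ?_⟩
      rw [hcoeff, hwr]
      ext1 s
      rw [coeff_monomial, if_pos rfl]

/-- The degrees in which the Koszul homology of products of powers of ideals does not vanish form
a finite union of shifted semigroups generated by degrees of generators of the ideals. -/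
theorem exists_cones_hasKoszulClass {d : (i : Fin m) → Fin (g i) → ℕ}
    (hf : ∀ i l, (f i l).IsHomogeneous (d i l))
    (hI : ∀ i, (Ideal.span (Set.range (f i))).IsHomogeneous (homogeneousSubmodule (Fin n) K))
    (j : ℕ) :
    ∃ (b : ℕ) (p : Fin b → (Fin m → ℕ) × ℕ) (V : Fin b → Set (Σ i, Fin (g i))),
      ∀ (a : Fin m → ℕ) (e : ℕ),
        HasKoszulClass (polynomialProjection K n) (∏ i, Ideal.span (Set.range (f i)) ^ a i) j e ↔
          ∃ k, ∃ q ∈ AddSubmonoid.closure (generatorDegree d '' V k), (a, e) = p k + q := by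
  have hφ : reesCycles f ≤ LinearMap.range ((Algebra.linearMap (multiRees f)
      (MvPolynomial (Fin m) (MvPolynomial (Fin n) K))).compLeft (Finset (Fin n))) := inf_le_left
  have hL : IsNoetherian (multiRees f) (Finset (Fin n) → multiRees f) :=
    isNoetherian_pi (R := multiRees f) (M := fun _ => multiRees f)
  obtain ⟨b, p, V, h, hV⟩ := exists_cone_decomposition (K := K) (A := multiRees f)
    (M := Finset (Fin n) → MvPolynomial (Fin m) (MvPolynomial (Fin n) K))
    (Γ := (Fin m → ℕ) × ℕ) (y := multiRees.gen f) (multiRees.adjoin_gen f)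
    (δ := reesDegree d) (H := homogeneousChains K n m j)
    (gen_smul_mem_homogeneousChains f hf) (proj := chainProjection K n m)
    chainProjection_eq_self chainProjection_eq_zero (L := Finset (Fin n) → multiRees f)
    _ (reesCycles f) hφ (reesBoundaries f) (reesBoundaries_le_reesCycles f)
    (chainProjection_mem_reesBoundaries f hI)
  refine ⟨b, p, fun k => Sum.inr ⁻¹' V k, fun a e => ?_⟩
  refine ((exists_homogeneousChains_iff f j (a, e)).symm.trans (h (a, e))).trans ?_
  -- No variable $x_i$ occurs in `V k`: for a cycle `u`, wedging with $e_i$ gives a chain with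
  -- boundary $x_iu$, so $x_i$ annihilates the homology.
  have hVk : ∀ k, reesDegree d '' V k = generatorDegree d '' (Sum.inr ⁻¹' V k) := by
    intro k
    ext x
    constructor
    · rintro ⟨i | v, hv, rfl⟩
      · exfalso
        obtain ⟨u, hu, hub⟩ := hV k _ hv
        obtain ⟨hu1, hu2⟩ := (mem_reesCycles f).mp hu
        refine hub ((mem_reesBoundaries f).mpr
          ⟨koszulWedge (MvPolynomial (Fin m) (MvPolynomial (Fin n) K)) i u, fun s => ?_, ?_⟩)
        · rw [koszulWedge_apply]
          split_ifs
          · exact zsmul_mem (hu1 _) _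
          · exact zero_mem _
        · refine (koszulOn_wedge
            (fun i => (C (X i) : MvPolynomial (Fin m) (MvPolynomial (Fin n) K)))
            (Finset.mem_univ i) u).trans ?_
          have hu3 : koszulOn (fun i =>
              (C (X i) : MvPolynomial (Fin m) (MvPolynomial (Fin n) K))) Finset.univ u = 0 := hu2
          rw [hu3, map_zero, sub_zero]
          rfl
      · exact ⟨v, hv, rfl⟩
    · rintro ⟨v, hv, rfl⟩
      exact ⟨_, hv, rfl⟩
  simp only [hVk]

end ReesAlgebra

/-! ### Projective dimension as the length of a minimal resolution -/

section ProjectiveDimension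

variable {K : Type*} [Field K] {n : ℕ}

/-- If the image of a minimal map is projective, then the map is injective. -/
lemma ker_eq_bot_of_projective_range {r : ℕ} {N : Type*} [AddCommGroup N]
    [Module (MvPolynomial (Fin n) K) N]
    (π : (Fin r → MvPolynomial (Fin n) K) →ₗ[MvPolynomial (Fin n) K] N)
    (hker : ∀ u, π u = 0 → ∀ k, constantCoeff (u k) = 0)
    (hproj : Module.Projective (MvPolynomial (Fin n) K) (LinearMap.range π)) :
    LinearMap.ker π = ⊥ := by
  obtain ⟨σ, hσ⟩ := π.rangeRestrict.exists_rightInverse_of_surjective π.range_rangeRestrict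
  -- A retraction of the free module onto the kernel. As the kernel lies in $(x)F$, applying `ρ`
  -- puts it in $(x)\ker\pi$. Nakayama then gives an $a\equiv1$ modulo $(x)$ that annihilates the
  -- kernel, which is torsion-free.
  let ρ := LinearMap.id - σ ∘ₗ π.rangeRestrict
  have hρ : ∀ u, ρ u ∈ LinearMap.ker π := fun u => by
    have h := congrArg Subtype.val (LinearMap.congr_fun hσ (π.rangeRestrict u))
    have h' : π (σ (π.rangeRestrict u)) = π u := h
    simp only [ρ, LinearMap.mem_ker, LinearMap.sub_apply, map_sub, LinearMap.id_apply,
      LinearMap.comp_apply, h', sub_self]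
  have hρ_ker : ∀ u ∈ LinearMap.ker π, ρ u = u := fun u hu => by
    have h : π.rangeRestrict u = 0 := Subtype.ext hu
    simp [ρ, h]
  obtain ⟨a, ha1, ha⟩ := Submodule.exists_sub_one_mem_and_smul_eq_zero_of_fg_of_le_smul
    (RingHom.ker (constantCoeff (R := K) (σ := Fin n))) (LinearMap.ker π)
    (IsNoetherian.noetherian _) (fun u hu => by
      rw [← hρ_ker u hu, LinearMap.pi_apply_eq_sum_univ ρ u]
      exact sum_mem fun k _ => Submodule.smul_mem_smul
        ((RingHom.mem_ker).mpr (hker u hu k)) (hρ _))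
  have ha0 : a ≠ 0 := by
    rintro rfl
    simp [RingHom.mem_ker] at ha1
  rw [eq_bot_iff]
  intro u hu
  exact (smul_eq_zero.mp (ha u hu)).resolve_left ha0

end ProjectiveDimension

section ProjectiveDimension

universe u

variable {K : Type u} [Field K] {n : ℕ}

lemma hasProjectiveDimensionLT_range_iff {R : Type u} [CommRing R] {F N : Type u} [AddCommGroup F]
    [Module R F] [Module.Projective R F] [AddCommGroup N] [Module R N] (π : F →ₗ[R] N) (k : ℕ) :
    HasProjectiveDimensionLT (ModuleCat.of R (LinearMap.range π)) (k + 2) ↔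
      HasProjectiveDimensionLT (ModuleCat.of R (LinearMap.ker π)) (k + 1) := by
  have h := (LinearMap.shortExact_shortComplexKer
    π.surjective_rangeRestrict).hasProjectiveDimensionLT_X₃_iff k
      ((IsProjective.iff_projective F).mp ‹_›)
  rw [← LinearMap.ker_rangeRestrict]
  exact h

namespace MinimalGradedFreeResolution

variable {I : Ideal (MvPolynomial (Fin n) K)} (F : MinimalGradedFreeResolution I)

lemma hasProjectiveDimensionLT_range_diff_iff (j k : ℕ) :
    HasProjectiveDimensionLT
        (ModuleCat.of (MvPolynomial (Fin n) K) (LinearMap.range (F.diff j))) (k + 1) ↔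
      Module.Projective (MvPolynomial (Fin n) K) (LinearMap.range (F.diff (j + k))) := by
  induction k generalizing j with
  | zero => rw [← projective_iff_hasProjectiveDimensionLT_one, IsProjective.iff_projective]; rfl
  | succ k ih =>
    rw [hasProjectiveDimensionLT_range_iff, ker_diff_eq, ih, add_right_comm, add_assoc]

lemma hasProjectiveDimensionLT_one_iff :
    HasProjectiveDimensionLT (ModuleCat.of (MvPolynomial (Fin n) K) I) 1 ↔
      Module.Projective (MvPolynomial (Fin n) K) (LinearMap.range F.aug) := by
  rw [← projective_iff_hasProjectiveDimensionLT_one, ← IsProjective.iff_projective, F.range_aug]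

lemma hasProjectiveDimensionLT_add_two_iff (k : ℕ) :
    HasProjectiveDimensionLT (ModuleCat.of (MvPolynomial (Fin n) K) I) (k + 2) ↔
      Module.Projective (MvPolynomial (Fin n) K) (LinearMap.range (F.diff k)) := by
  have h := hasProjectiveDimensionLT_range_iff F.aug k
  rw [ker_aug_eq, hasProjectiveDimensionLT_range_diff_iff, zero_add] at h
  rw [← h, F.range_aug]

lemma rank_succ_eq_zero_iff (j : ℕ) : F.rank (j + 1) = 0 ↔ LinearMap.range (F.diff j) = ⊥ := by
  constructor
  · intro h
    rw [LinearMap.range_eq_bot]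
    ext k
    exact (Fin.cast h k).elim0
  · intro h
    by_contra hne
    let k : Fin (F.rank (j + 1)) := ⟨0, Nat.pos_of_ne_zero hne⟩
    have h1 := F.constantCoeff_of_diff_eq_zero (j := j) (u := Pi.single k 1)
      (by rw [LinearMap.range_eq_bot.mp h]; rfl) k
    simp at h1

lemma projective_range_diff_iff (j : ℕ) :
    Module.Projective (MvPolynomial (Fin n) K) (LinearMap.range (F.diff j)) ↔
      F.rank (j + 2) = 0 := by
  rw [rank_succ_eq_zero_iff, ← ker_diff_eq]
  constructor
  · exact ker_eq_bot_of_projective_range _ fun u hu => F.constantCoeff_of_diff_eq_zero hu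
  · intro h
    exact Module.Projective.of_equiv (LinearEquiv.ofInjective _ (LinearMap.ker_eq_bot.mp h))

lemma projective_range_aug_iff :
    Module.Projective (MvPolynomial (Fin n) K) (LinearMap.range F.aug) ↔ F.rank 1 = 0 := by
  rw [rank_succ_eq_zero_iff, ← ker_aug_eq]
  constructor
  · exact ker_eq_bot_of_projective_range _ fun u hu => F.constantCoeff_of_aug_eq_zero hu
  · intro h
    exact Module.Projective.of_equiv (LinearEquiv.ofInjective _ (LinearMap.ker_eq_bot.mp h))

/-- The projective dimension is at most `p` exactly when the `p`-th syzygy module is projective; its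
minimal cover is then injective, so the next free module vanishes. -/
lemma hasProjectiveDimensionLT_succ_iff (p : ℕ) :
    HasProjectiveDimensionLT (ModuleCat.of (MvPolynomial (Fin n) K) I) (p + 1) ↔
      F.rank (p + 1) = 0 := by
  cases p with
  | zero => rw [hasProjectiveDimensionLT_one_iff F, projective_range_aug_iff]
  | succ p => rw [hasProjectiveDimensionLT_add_two_iff F, projective_range_diff_iff]

include F in
lemma rank_zero_ne_zero (hI : I ≠ ⊥) : F.rank 0 ≠ 0 := by
  intro h
  apply hI
  rw [← F.range_aug, LinearMap.range_eq_bot]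
  ext k
  exact (Fin.cast h k).elim0

/-- The projective dimension is the length of the minimal graded free resolution. -/
lemma projectiveDimension_eq (hI : I ≠ ⊥) {p : ℕ} (hp : F.rank p ≠ 0)
    (hp' : F.rank (p + 1) = 0) :
    projectiveDimension (ModuleCat.of (MvPolynomial (Fin n) K) I) = (p : WithBot ℕ∞) := by
  refine le_antisymm ((projectiveDimension_le_iff _ _).mpr
    ((F.hasProjectiveDimensionLT_succ_iff p).mpr hp')) ((projectiveDimension_ge_iff _ _).mpr ?_)
  intro h
  cases p with
  | zero =>
    have h0 := (hasProjectiveDimensionLT_zero_iff_isZero _).mp h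
    have := ModuleCat.subsingleton_of_isZero h0
    exact hI (Submodule.subsingleton_iff_eq_bot.mp this)
  | succ p => exact hp ((F.hasProjectiveDimensionLT_succ_iff p).mp h)

end MinimalGradedFreeResolution

end ProjectiveDimension

/-! ### Asymptotic behaviour of the invariants -/

section Asymptotics

variable {K : Type*} [Field K] {n : ℕ}

lemma maxSyzygyDegree_eq_bot {I : Ideal (MvPolynomial (Fin n) K)} {j : ℕ}
    (h : ∀ d : ℤ, ¬ HasKoszulClass (polynomialProjection K n) I j d) :
    maxSyzygyDegree j I = ⊥ := by
  refine iSup₂_eq_bot.mpr fun F k => ?_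
  exact absurd ((F.hasKoszulClass_iff j (F.deg j k)).mpr ⟨k, rfl⟩) (h _)

/-- The upper bound holds for every resolution; the lower bound needs that one exists, as otherwise
the supremum defining `maxSyzygyDegree` would be empty. -/
lemma maxSyzygyDegree_eq_iSup {I : Ideal (MvPolynomial (Fin n) K)}
    (hI : I.IsHomogeneous (homogeneousSubmodule (Fin n) K)) {j b : ℕ} (L : Fin b → ℤ)
    (h₁ : ∀ k, ∃ e : ℕ, HasKoszulClass (polynomialProjection K n) I j e ∧ (e : ℤ) = L k)
    (h₂ : ∀ e : ℕ, HasKoszulClass (polynomialProjection K n) I j e → ∃ k, (e : ℤ) ≤ L k) :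
    maxSyzygyDegree j I = ⨆ k, (((L k : ℤ) : ℝ) : EReal) := by
  refine le_antisymm (iSup₂_le fun F k => ?_) (iSup_le fun k => ?_)
  · obtain ⟨k', hk'⟩ := h₂ _ ((F.hasKoszulClass_iff j (F.deg j k)).mpr ⟨k, rfl⟩)
    refine le_iSup_of_le k' (EReal.coe_le_coe_iff.mpr ?_)
    exact_mod_cast hk'
  · obtain ⟨e, he, hek⟩ := h₁ k
    obtain ⟨k', hk'⟩ := ((minimalGradedFreeResolution I hI).hasKoszulClass_iff j e).mp he
    refine le_iSup₂_of_le (minimalGradedFreeResolution I hI) k' (EReal.coe_le_coe_iff.mpr ?_)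
    rw [← hek, ← hk']
    simp

end Asymptotics

theorem theorem1 {K : Type*} [Field K] {n m : ℕ} (hn : 1 ≤ n)
    (I : Fin m → Ideal (MvPolynomial (Fin n) K))
    (hI_ne : ∀ i, I i ≠ ⊥)
    (hI_hom : ∀ i, (I i).IsHomogeneous (homogeneousSubmodule (Fin n) K))
    (g : Fin m → ℕ)
    (f : (i : Fin m) → Fin (g i) → MvPolynomial (Fin n) K)
    (d : (i : Fin m) → Fin (g i) → ℕ)
    (hf : ∀ i, IsMinimalHomogeneousGeneratingSystem (I i) (f i) (d i)) :
    ∃ (b : Fin n → ℕ) (lam : (j : Fin n) → Fin (b j) → Fin m → ℕ)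
      (lam0 : (j : Fin n) → Fin (b j) → ℤ),
      (∀ j k i, lam j k i ∈ Set.range (d i)) ∧
      (∀ j : Fin n, ∃ c : Fin m → ℕ, ∀ a : Fin m → ℕ, c ≤ a →
        maxSyzygyDegree (j : ℕ) (∏ i, I i ^ a i) =
          ⨆ k : Fin (b j),
            (((∑ i, (lam j k i : ℤ) * (a i : ℤ) + lam0 j k : ℤ) : ℝ) : EReal)) ∧
      (∃ (p : ℕ) (c : Fin m → ℕ), ∀ a : Fin m → ℕ, c ≤ a →
        projectiveDimension
          (ModuleCat.of (MvPolynomial (Fin n) K) ↥(∏ i, I i ^ a i)) = (p : WithBot ℕ∞)) ∧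
      (∃ c : Fin m → ℕ, ∀ a : Fin m → ℕ, c ≤ a →
        castelnuovoMumfordRegularity (∏ i, I i ^ a i) =
          ⨆ (j : Fin n) (k : Fin (b j)),
            (((∑ i, (lam j k i : ℤ) * (a i : ℤ) + lam0 j k - (j : ℕ) : ℤ) : ℝ) : EReal)) := by
  classical
  have hspan : ∀ i, Ideal.span (Set.range (f i)) = I i := fun i => (hf i).span_eq
  have key : ∀ j : Fin n, ∃ (b : ℕ) (lam : Fin b → Fin m → ℕ) (lam0 : Fin b → ℤ) (c : Fin m → ℕ),
      (∀ k i, lam k i ∈ Set.range (d i)) ∧ ∀ a : Fin m → ℕ, c ≤ a →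
      (∀ k, ∃ e : ℕ, HasKoszulClass (polynomialProjection K n) (∏ i, I i ^ a i) j e ∧
        (e : ℤ) = ∑ i, (lam k i : ℤ) * (a i : ℤ) + lam0 k) ∧
      (∀ e : ℕ, HasKoszulClass (polynomialProjection K n) (∏ i, I i ^ a i) j e →
        ∃ k, (e : ℤ) ≤ ∑ i, (lam k i : ℤ) * (a i : ℤ) + lam0 k) := by
    intro j
    obtain ⟨b, p, V, h⟩ := exists_cones_hasKoszulClass f (d := d)
      (fun i l => (hf i).homogeneous l) (fun i => by rw [hspan]; exact hI_hom i) j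
    simp only [hspan] at h
    simp only [h]
    exact exists_linear_bounds_of_cones p V
  choose b lam lam0 c hlam hc using key
  have hprod_hom : ∀ a : Fin m → ℕ,
      (∏ i, I i ^ a i).IsHomogeneous (homogeneousSubmodule (Fin n) K) :=
    prod_pow_isHomogeneous hI_hom
  have hprod_ne : ∀ a : Fin m → ℕ, ∏ i, I i ^ a i ≠ ⊥ := fun a =>
    Finset.prod_ne_zero_iff.mpr fun i _ => pow_ne_zero _ (hI_ne i)
  have ht : ∀ j : Fin n, ∀ a : Fin m → ℕ, c j ≤ a →
      maxSyzygyDegree (j : ℕ) (∏ i, I i ^ a i) = ⨆ k : Fin (b j),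
        (((∑ i, (lam j k i : ℤ) * (a i : ℤ) + lam0 j k : ℤ) : ℝ) : EReal) := fun j a ha =>
    maxSyzygyDegree_eq_iSup (hprod_hom a) _ (hc j a ha).1 (hc j a ha).2
  -- One threshold above those of all `j`.
  let c' : Fin m → ℕ := fun i => ∑ j, c j i
  have hc' : ∀ j, c j ≤ c' := fun j i =>
    Finset.single_le_sum (f := fun j => c j i) (fun _ _ => Nat.zero_le _) (Finset.mem_univ j)
  have hrank : ∀ (a : Fin m → ℕ) (F : MinimalGradedFreeResolution (∏ i, I i ^ a i)) (j : Fin n),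
      c j ≤ a → (F.rank j = 0 ↔ b j = 0) := by
    intro a F j ha
    rw [← not_iff_not]
    constructor
    · intro h
      obtain ⟨k, -⟩ := (hc j a ha).2 _
        ((F.hasKoszulClass_iff j _).mpr ⟨⟨0, Nat.pos_of_ne_zero h⟩, rfl⟩)
      exact Nat.ne_of_gt k.pos
    · intro h
      obtain ⟨e, he, -⟩ := (hc j a ha).1 ⟨0, Nat.pos_of_ne_zero h⟩
      obtain ⟨k, -⟩ := (F.hasKoszulClass_iff j _).mp he
      exact Nat.ne_of_gt k.pos
  refine ⟨b, lam, lam0, hlam, fun j => ⟨c j, ht j⟩, ?_, c', fun a ha => ?_⟩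
  -- The projective dimension is the largest `j` with `b j ≠ 0`. Such `j` exist: `b 0 ≠ 0`, since a
  -- nonzero ideal has a generator.
  · let S : Finset (Fin n) := Finset.univ.filter fun j => b j ≠ 0
    have hS : S.Nonempty := by
      refine ⟨⟨0, hn⟩, Finset.mem_filter.mpr ⟨Finset.mem_univ _, ?_⟩⟩
      let F := minimalGradedFreeResolution _ (hprod_hom c')
      exact (not_congr (hrank c' F ⟨0, hn⟩ (hc' _))).mp (F.rank_zero_ne_zero (hprod_ne c'))
    let p := S.max' hS
    refine ⟨p, c', fun a ha => ?_⟩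
    let F := minimalGradedFreeResolution _ (hprod_hom a)
    refine F.projectiveDimension_eq (hprod_ne a) ?_ ?_
    · exact (not_congr (hrank a F p ((hc' p).trans ha))).mpr
        (Finset.mem_filter.mp (S.max'_mem hS)).2
    · by_cases hp : (p : ℕ) + 1 < n
      · refine (hrank a F ⟨p + 1, hp⟩ ((hc' _).trans ha)).mpr ?_
        by_contra h
        have h1 : (⟨p + 1, hp⟩ : Fin n) ≤ p :=
          S.le_max' _ (Finset.mem_filter.mpr ⟨Finset.mem_univ _, h⟩)
        have h2 : (p : ℕ) + 1 ≤ p := h1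
        omega
      · by_contra h
        exact not_hasKoszulClass_of_le hn _ _ (not_lt.mp hp) _
          ((F.hasKoszulClass_iff (p + 1) _).mpr ⟨⟨0, Nat.pos_of_ne_zero h⟩, rfl⟩)
  · have hcast : ∀ (z : ℤ) (j : ℕ), (((z - (j : ℤ) : ℤ) : ℝ) : EReal) =
        ((z : ℝ) : EReal) - ((j : ℝ) : EReal) := fun z j => by
      rw [← EReal.coe_sub]; push_cast; rfl
    refine le_antisymm (iSup_le fun j => ?_) (iSup₂_le fun j k => ?_)
    -- The supremum defining the regularity runs over all `j`; those with `j ≥ n` contribute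
    -- $-\infty$.
    · by_cases hj : j < n
      · rw [ht ⟨j, hj⟩ a ((hc' _).trans ha),
          EReal.sub_le_iff_le_add (Or.inl (EReal.coe_ne_bot _)) (Or.inl (EReal.coe_ne_top _))]
        refine iSup_le fun k => ?_
        rw [← EReal.sub_le_iff_le_add (Or.inl (EReal.coe_ne_bot _))
          (Or.inl (EReal.coe_ne_top _)), ← hcast]
        exact le_iSup₂_of_le (f := fun (j : Fin n) (k : Fin (b j)) =>
          (((∑ i, (lam j k i : ℤ) * (a i : ℤ) + lam0 j k - (j : ℕ) : ℤ) : ℝ) : EReal))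
          ⟨j, hj⟩ k le_rfl
      · rw [maxSyzygyDegree_eq_bot fun d => not_hasKoszulClass_of_le hn _ _ (not_lt.mp hj) d,
          EReal.bot_sub]
        exact bot_le
    · rw [hcast]
      refine le_iSup_of_le (j : ℕ) (EReal.sub_le_sub ?_ le_rfl)
      rw [ht j a ((hc' j).trans ha)]
      exact le_iSup (fun k : Fin (b j) =>
        (((∑ i, (lam j k i : ℤ) * (a i : ℤ) + lam0 j k : ℤ) : ℝ) : EReal)) k
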